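/- All graphs are finite, simple and undirected. A graph $G$ is $m$-connected if $|V(G)|>m$ and $G-S$ is connected for every $S\subseteq V(G)$ with $|S|<m$; it is $(K_2\cup kK_1)$-free if no induced subgraph of $G$ is isomorphic to the disjoint union of one edge and $k$ isolated vertices. Let $\delta(G)$ be the minimum degree, $\alpha(G)$ the independence number and $\omega(G)$ the number of components of $G$, and let the toughness be $$t(G)=\min\left\{\frac{|S|}{\omega(G-S)} : S\subseteq V(G),\ \omega(G-S)\ge 2\right\},$$ with $t(G)=\infty$ if $G$ is complete. Let $k\ge 2$ be an integer and let $G$ be a $(k+1)$-connected $(K_2\cup kK_1)$-free graph. Then $\alpha(G)<\frac{|V(G)|}{2}$ if and only if $t(G)>1$. Moreover, if $\delta(G)\ge\frac{3k-1}{2}$ and $\alpha(G)<\frac{|V(G)|}{2}$, then $G$ is hamiltonian-connected: for every pair of distinct vertices $u,v$ of $G$ there is a path from $u$ to $v$ containing all vertices of $G$. -/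

import Mathlib

namespace SimpleGraph

variable {V : Type*}

/-- `G` is `k`-connected: it has more than `k` vertices, and deleting fewer than `k` vertices
always leaves a connected graph. -/
def IsVertexConnected (G : SimpleGraph V) (k : ℕ) : Prop :=
  k < Nat.card V ∧ ∀ S : Finset V, S.card < k → (G.induce {v | v ∉ S}).Connected

/-- `G` has no induced subgraph isomorphic to `K₂ ∪ kK₁`, the disjoint union of an edge and `k`
isolated vertices. -/
def IsK2UnionKK1Free (G : SimpleGraph V) (k : ℕ) : Prop :=
  ¬ ((⊤ : SimpleGraph (Fin 2)) ⊕g (⊥ : SimpleGraph (Fin k))) ⊴ G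

/-- The number of connected components of `G - S`. -/
noncomputable def numComponentsDelete (G : SimpleGraph V) (S : Finset V) : ℕ :=
  Nat.card (G.induce {v | v ∉ S}).ConnectedComponent

/-- The toughness of a finite graph: the least value of `|S| / ω(G - S)` over the vertex sets `S`
for which `G - S` has at least two components. There are no such sets exactly when `G` is
complete, and then the toughness is `∞`. -/
noncomputable def toughness (G : SimpleGraph V) : ENNReal :=
  ⨅ (S : Finset V) (_ : 2 ≤ G.numComponentsDelete S),
    (S.card : ENNReal) / (G.numComponentsDelete S : ENNReal)

/-- `G` is hamiltonian-connected: any two distinct vertices are joined by a spanning path. -/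
def IsHamiltonianConnected [DecidableEq V] (G : SimpleGraph V) : Prop :=
  ∀ u v : V, u ≠ v → ∃ p : G.Walk u v, p.IsHamiltonian

end SimpleGraph

/-! Toughness. Suppose `G - S` has at least two components, and at least |S| of them. Connectivity
gives |S| ≥ k + 1. An edge of `G - S` together with one vertex from each of the at least k other
components would induce K₂ ∪ kK₁. So `G - S` is edgeless and its vertices form an independent set
containing at least half of V. Conversely, the complement of a maximum independent set of at least
half the vertices has ratio at most 1.

Hamiltonian-connectedness. Join a new vertex ω to the prescribed ends x and y: a spanning cycle
through ω yields a spanning path from x to y. Take a longest cycle through ω and suppose that it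
misses h. Connectivity and freeness make the vertices off the cycle independent (`not_adj_of_off`),
so all neighbours of h lie on the cycle; their number d is at least k + 1 and at least (3k - 1)/2,
and ω is not among them. Collapsing the arc between consecutive neighbours that contains ω leaves m
= d - 1 junctions, with m ≥ k and 2m + 3 ≥ 3k. Write w j and u j for the vertices just after and
just before the j-th junction.

By the usual exchange argument h and the w j are independent. They lie in an independent set J such
that every vertex other than ω outside J has fewer than k non-neighbours in J. Since α < n/2, two
consecutive cycle vertices avoid both J and ω. The main tool, `lt_of_adj_cut`, says that in a window
of m indices starting at a cut edge of the cycle, the w-neighbours of the second end all precede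
those of the first. Counting neighbours in such windows, `exists_u_notMem`, `w_mem_rev_J` and
`not_lt_m` each end in 2m + 4 ≤ 3k, which is impossible. Hence m = k, and so k ≤ 3. For k = 2 the
bounds of `exists_first` clash. For k = 3 the structure is rigid, and w 1 has at most three
neighbours besides ω although the minimum degree is at least 4. -/

namespace SimpleGraph

/-! ### Paths as vertex lists, and longest cycles. -/

variable {X : Type*}

/-- `l` lists the vertices of a walk from `a` to `b`. -/
def PathList (Γ : SimpleGraph X) (l : List X) (a b : X) : Prop :=
  l.IsChain Γ.Adj ∧ l.head? = some a ∧ l.getLast? = some b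

namespace PathList

variable {Γ : SimpleGraph X} {l l' : List X} {a b a' b' : X}

lemma singleton (Γ : SimpleGraph X) (a : X) : PathList Γ [a] a a := by
  simp [PathList]

lemma append (h : PathList Γ l a b) (h' : PathList Γ l' a' b') (hadj : Γ.Adj b a') :
    PathList Γ (l ++ l') a b' := by
  obtain ⟨h1, h2, h3⟩ := h
  obtain ⟨h1', h2', h3'⟩ := h'
  refine ⟨List.isChain_append.2 ⟨h1, h1', ?_⟩, ?_, ?_⟩
  · intro x hx y hy
    rw [h3] at hx; rw [h2'] at hy
    simp only [Option.mem_def, Option.some.injEq] at hx hy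
    subst hx hy
    exact hadj
  · simp [List.head?_append, h2]
  · simp [List.getLast?_append, h3']

lemma reverse (h : PathList Γ l a b) : PathList Γ l.reverse b a := by
  obtain ⟨h1, h2, h3⟩ := h
  refine ⟨?_, by simp [h3], by simp [h2]⟩
  rw [List.isChain_reverse]
  exact h1.imp fun _ _ h => h.symm

end PathList

/-- A longest cycle of `Γ` through `ω`, parametrised periodically by the integers. -/
structure LongestCycle (Γ : SimpleGraph X) (ω : X) where
  n : ℕ
  c : ℤ → X
  periodic : ∀ i, c (i + n) = c i
  inj : ∀ i j, c i = c j → (n : ℤ) ∣ i - j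
  adj : ∀ i, Γ.Adj (c i) (c (i + 1))
  three_le : 3 ≤ n
  exists_eq : ∃ i, c i = ω
  length_le : ∀ l a b, PathList Γ l a b → Γ.Adj b a → l.Nodup → ω ∈ l → l.length ≤ n

namespace LongestCycle

variable {Γ : SimpleGraph X} {ω : X} (C : LongestCycle Γ ω)

/-- The vertices of the cycle at the positions `i ≤ t < j`. -/
def seg (i j : ℤ) : List X := (List.range (j - i).toNat).map fun t : ℕ => C.c (i + t)

lemma seg_append {i j k : ℤ} (hij : i ≤ j) (hjk : j ≤ k) : C.seg i k = C.seg i j ++ C.seg j k := by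
  obtain ⟨a, rfl⟩ := Int.le.dest hij
  obtain ⟨b, rfl⟩ := Int.le.dest hjk
  have h1 : (i + a + b - i).toNat = a + b := by omega
  have h2 : (i + a - i).toNat = a := by omega
  have h3 : (i + a + b - (i + a)).toNat = b := by omega
  simp only [seg, h1, h2, h3, List.range_add, List.map_append, List.map_map]
  congr 1
  apply List.map_congr_left
  intro t _
  simp [add_assoc]

lemma seg_succ (i : ℤ) : C.seg i (i + 1) = [C.c i] := by
  simp [seg]

lemma length_seg (i j : ℤ) : (C.seg i j).length = (j - i).toNat := by simp [seg]

lemma mem_seg {i j : ℤ} {z : X} : z ∈ C.seg i j ↔ ∃ t, i ≤ t ∧ t < j ∧ C.c t = z := by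
  simp only [seg, List.mem_map, List.mem_range]
  constructor
  · rintro ⟨t, ht, rfl⟩
    exact ⟨i + t, by omega, by omega, rfl⟩
  · rintro ⟨t, h1, h2, rfl⟩
    exact ⟨(t - i).toNat, by omega, by congr 1; omega⟩

lemma pathList_seg {i j e : ℤ} (he : j = e + 1) (h : i ≤ e) :
    PathList Γ (C.seg i j) (C.c i) (C.c e) := by
  subst he
  obtain ⟨a, rfl⟩ := Int.le.dest h
  clear h
  induction a with
  | zero => simpa [seg_succ] using PathList.singleton Γ (C.c i)
  | succ a ih =>
    rw [C.seg_append (j := i + a + 1) (by omega) (by push_cast; omega)]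
    push_cast
    rw [← add_assoc, seg_succ]
    exact ih.append (PathList.singleton _ _) (C.adj _)

lemma nodup_seg (s : ℤ) : (C.seg s (s + C.n)).Nodup := by
  have : (s + C.n - s).toNat = C.n := by omega
  rw [seg, this]
  refine List.Nodup.map_on ?_ List.nodup_range
  intro x hx y hy hxy
  have := C.inj _ _ hxy
  rw [List.mem_range] at hx hy
  have h2 : (s + x - (s + y) : ℤ) = x - y := by ring
  rw [h2] at this
  have := Int.eq_zero_of_abs_lt_dvd this (by rw [abs_lt]; omega)
  omega

lemma n_pos : 0 < C.n := by have := C.three_le; omega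

lemma periodic_mul (i k : ℤ) : C.c (i + k * C.n) = C.c i := by
  have h : Function.Periodic C.c (C.n : ℤ) := C.periodic
  exact h.int_mul k i

lemma exists_mem_Ico (i s : ℤ) : ∃ t, s ≤ t ∧ t < s + C.n ∧ C.c t = C.c i ∧ (C.n : ℤ) ∣ i - t := by
  have hn : (0 : ℤ) < C.n := by exact_mod_cast C.n_pos
  refine ⟨s + (i - s) % C.n, ?_, ?_, ?_, ?_⟩
  · have := Int.emod_nonneg (i - s) hn.ne'; omega
  · have := Int.emod_lt_of_pos (i - s) hn; omega
  · have h1 := Int.emod_add_mul_ediv (i - s) C.n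
    have h2 : i = s + (i - s) % C.n + (i - s) / C.n * C.n := by linarith
    conv_rhs => rw [h2]
    rw [periodic_mul]
  · have h1 := Int.emod_add_mul_ediv (i - s) C.n
    exact ⟨(i - s) / C.n, by linarith⟩

lemma eq_of_c_eq {i j : ℤ} (h : C.c i = C.c j) (h1 : i < j + C.n) (h2 : j < i + C.n) : i = j := by
  have := Int.eq_zero_of_abs_lt_dvd (C.inj _ _ h) (by rw [abs_lt]; omega)
  omega

lemma omega_mem_seg (s : ℤ) : ω ∈ C.seg s (s + C.n) := by
  obtain ⟨i, hi⟩ := C.exists_eq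
  obtain ⟨t, h1, h2, h3, -⟩ := C.exists_mem_Ico i s
  exact C.mem_seg.2 ⟨t, h1, h2, h3.trans hi⟩

/-- The cycle cannot be extended by the vertices of a nonempty list off the cycle. -/
lemma not_perm {l e : List X} {a b : X} {s : ℤ} (hl : PathList Γ l a b) (hba : Γ.Adj b a)
    (hp : l.Perm (e ++ C.seg s (s + C.n))) (he : e.Nodup) (hne : e ≠ [])
    (hd : ∀ z ∈ e, ∀ i, C.c i ≠ z) : False := by
  have hnd : l.Nodup := by
    rw [hp.nodup_iff, List.nodup_append]
    refine ⟨he, C.nodup_seg s, ?_⟩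
    rintro z hz _ hz' rfl
    obtain ⟨t, -, -, ht⟩ := C.mem_seg.1 hz'
    exact hd z hz t ht
  have h1 := C.length_le l a b hl hba hnd
    (hp.mem_iff.2 (List.mem_append_right _ (C.omega_mem_seg s)))
  rw [hp.length_eq, List.length_append, length_seg] at h1
  have := List.length_pos_iff.2 hne
  omega

/-- Otherwise the detour `e` could replace the cycle edge from `t` to `t + 1`. -/
lemma not_adj_of_adj {e : List X} {a b : X} (hl : PathList Γ e a b) (he : e.Nodup)
    (hd : ∀ z ∈ e, ∀ i, C.c i ≠ z) {t : ℤ} (ha : Γ.Adj a (C.c t)) : ¬ Γ.Adj b (C.c (t + 1)) := by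
  intro hb
  have h0 := C.three_le
  have hne : e ≠ [] := by rintro rfl; simp [PathList] at hl
  have h1 := C.pathList_seg (i := t + 1) (j := t + 1 + C.n) (e := t + C.n) (by ring) (by omega)
  rw [C.periodic] at h1
  exact C.not_perm (hl.append h1 hb) ha.symm (List.Perm.refl _) he hne hd

/-- The longer cycle would be `e`, then `j` back to `i + 1`, then `j + 1` forward around to `i`. -/
lemma not_adj_succ_succ {e : List X} {a b : X} (hl : PathList Γ e a b) (he : e.Nodup)
    (hd : ∀ z ∈ e, ∀ i, C.c i ≠ z) {i j : ℤ} (hij : i < j) (hji : j < i + C.n)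
    (ha : Γ.Adj a (C.c i)) (hb : Γ.Adj b (C.c j)) : ¬ Γ.Adj (C.c (i + 1)) (C.c (j + 1)) := by
  intro h
  have h1 := C.pathList_seg (i := i + 1) (j := j + 1) (e := j) rfl (by omega)
  have h2 := C.pathList_seg (i := j + 1) (j := i + 1 + C.n) (e := i + C.n) (by ring) (by omega)
  rw [C.periodic] at h2
  have hne : e ≠ [] := by rintro rfl; simp [PathList] at hl
  refine C.not_perm (s := i + 1) ((hl.append h1.reverse hb).append h2 h) ha.symm ?_ he hne hd
  rw [C.seg_append (i := i + 1) (j := j + 1) (k := i + 1 + C.n) (by omega) (by omega)]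
  classical
  rw [List.perm_iff_count]; intro z; simp [List.count_append, List.count_reverse]

lemma c_pred (s : ℤ) : C.c (s + C.n - 1) = C.c (s - 1) := by
  rw [← C.periodic (s - 1)]; congr 1; ring

/-! ### Rerouting rules: configurations that would give a longer cycle. -/

section Rules

variable {h : X} (hh : ∀ i, C.c i ≠ h)
include hh

lemma not_cons_perm {l : List X} {b : X} {s : ℤ} (hl : PathList Γ l h b) (hba : Γ.Adj b h)
    (hp : l.Perm (h :: C.seg s (s + C.n))) : False :=
  C.not_perm (e := [h]) hl hba hp (by simp) (by simp) (by simpa using hh)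

/-- Two vertices are absorbed at once: `h`, `j` back to `i + 1`, `z`, `j + 1` around to `i`. -/
lemma not_adj_two {z : X} (hz : ∀ i, C.c i ≠ z) (hzh : z ≠ h) {i j : ℤ} (hij : i < j)
    (hji : j < i + C.n) (hi : Γ.Adj h (C.c i)) (hj : Γ.Adj h (C.c j))
    (hzi : Γ.Adj z (C.c (i + 1))) (hzj : Γ.Adj z (C.c (j + 1))) : False := by
  have h1 := C.pathList_seg (i := i + 1) (j := j + 1) (e := j) rfl (by omega)
  have h2 := C.pathList_seg (i := j + 1) (j := i + 1 + C.n) (e := i + C.n) (by ring) (by omega)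
  rw [C.periodic] at h2
  refine C.not_perm (s := i + 1) (e := [h, z])
    ((((PathList.singleton Γ h).append h1.reverse hj).append
      (PathList.singleton Γ z) hzi.symm).append h2 hzj) hi.symm ?_ (by simp [hzh.symm]) (by simp)
      (by simp [hz, hh])
  rw [C.seg_append (i := i + 1) (j := j + 1) (k := i + 1 + C.n) (by omega) (by omega)]
  classical
  rw [List.perm_iff_count]; intro z
  simp [List.count_append, List.count_reverse, List.count_cons]; ring

/-- `s - 1, s` is a cut, `w, w'` the successors of neighbours `i < j` of `h`. -/
lemma not_adj_cut {s i j : ℤ} (hsi : s ≤ i) (hij : i < j) (hjs : j + 1 < s + C.n)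
    (hi : Γ.Adj h (C.c i)) (hj : Γ.Adj h (C.c j))
    (ha : Γ.Adj (C.c (s - 1)) (C.c (i + 1))) (hb : Γ.Adj (C.c s) (C.c (j + 1))) : False := by
  have h1 := C.pathList_seg (i := s) (j := i + 1) (e := i) rfl (by omega)
  have h2 := C.pathList_seg (i := i + 1) (j := j + 1) (e := j) rfl (by omega)
  have h3 := C.pathList_seg (i := j + 1) (j := s + C.n) (e := s + C.n - 1) (by ring) (by omega)
  rw [C.c_pred] at h3
  refine C.not_cons_perm hh (s := s) ((((PathList.singleton Γ h).append h2.reverse hj).append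
    h3.reverse ha.symm).append h1 hb.symm) hi.symm ?_
  rw [C.seg_append (i := s) (j := i + 1) (k := s + C.n) (by omega) (by omega),
    C.seg_append (i := i + 1) (j := j + 1) (k := s + C.n) (by omega) (by omega)]
  classical
  rw [List.perm_iff_count]; intro z
  simp [List.count_append, List.count_reverse, List.count_cons]; ring

/-- The vertex at `j + 1` moves into the cut edge from `s - 1` to `s`, and `h` takes its old place.
The next two rules use the same move when the vertex at `j + 2` is instead adjacent to the successor
of another neighbour of `h`. -/
lemma not_adj_insert_self {s j : ℤ} (hsj : s ≤ j) (hjs : j + 2 < s + C.n)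
    (hj : Γ.Adj h (C.c j)) (ha : Γ.Adj (C.c (s - 1)) (C.c (j + 1)))
    (hb : Γ.Adj (C.c s) (C.c (j + 1))) (hg : Γ.Adj h (C.c (j + 2))) : False := by
  have h1 := C.pathList_seg (i := s) (j := j + 1) (e := j) rfl (by omega)
  have h2 := C.pathList_seg (i := j + 1) (j := j + 2) (e := j + 1) (by ring) (by omega)
  have h3 := C.pathList_seg (i := j + 2) (j := s + C.n) (e := s + C.n - 1) (by ring) (by omega)
  rw [C.c_pred] at h3
  refine C.not_cons_perm hh (s := s) ((((PathList.singleton Γ h).append h1.reverse hj).append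
    h2 hb).append h3.reverse ha.symm) hg.symm ?_
  rw [C.seg_append (i := s) (j := j + 1) (k := s + C.n) (by omega) (by omega),
    C.seg_append (i := j + 1) (j := j + 2) (k := s + C.n) (by omega) (by omega)]
  classical
  rw [List.perm_iff_count]; intro z
  simp [List.count_append, List.count_reverse, List.count_cons]

lemma not_adj_insert_lt {s i j : ℤ} (hsi : s ≤ i) (hij : i < j) (hjs : j + 2 < s + C.n)
    (hi : Γ.Adj h (C.c i)) (hj : Γ.Adj h (C.c j)) (ha : Γ.Adj (C.c (s - 1)) (C.c (j + 1)))
    (hb : Γ.Adj (C.c s) (C.c (j + 1))) (hg : Γ.Adj (C.c (j + 2)) (C.c (i + 1))) : False := by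
  have h1 := C.pathList_seg (i := s) (j := i + 1) (e := i) rfl (by omega)
  have h2 := C.pathList_seg (i := i + 1) (j := j + 1) (e := j) rfl (by omega)
  have h3 := C.pathList_seg (i := j + 1) (j := j + 2) (e := j + 1) (by ring) (by omega)
  have h4 := C.pathList_seg (i := j + 2) (j := s + C.n) (e := s + C.n - 1) (by ring) (by omega)
  rw [C.c_pred] at h4
  refine C.not_cons_perm hh (s := s) (((((PathList.singleton Γ h).append h2.reverse hj).append
    h4 hg.symm).append h3 ha).append h1 hb.symm) hi.symm ?_
  rw [C.seg_append (i := s) (j := i + 1) (k := s + C.n) (by omega) (by omega),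
    C.seg_append (i := i + 1) (j := j + 1) (k := s + C.n) (by omega) (by omega),
    C.seg_append (i := j + 1) (j := j + 2) (k := s + C.n) (by omega) (by omega)]
  classical
  rw [List.perm_iff_count]; intro z
  simp [List.count_append, List.count_reverse, List.count_cons]; ring

lemma not_adj_insert_gt {s j l : ℤ} (hsj : s ≤ j) (hjl : j + 2 ≤ l) (hls : l + 1 < s + C.n)
    (hj : Γ.Adj h (C.c j)) (hl : Γ.Adj h (C.c l)) (ha : Γ.Adj (C.c (s - 1)) (C.c (j + 1)))
    (hb : Γ.Adj (C.c s) (C.c (j + 1))) (hg : Γ.Adj (C.c (j + 2)) (C.c (l + 1))) : False := by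
  have h1 := C.pathList_seg (i := s) (j := j + 1) (e := j) rfl (by omega)
  have h2 := C.pathList_seg (i := j + 1) (j := j + 2) (e := j + 1) (by ring) (by omega)
  have h3 := C.pathList_seg (i := j + 2) (j := l + 1) (e := l) rfl (by omega)
  have h4 := C.pathList_seg (i := l + 1) (j := s + C.n) (e := s + C.n - 1) (by ring) (by omega)
  rw [C.c_pred] at h4
  refine C.not_cons_perm hh (s := s) (((((PathList.singleton Γ h).append h1.reverse hj).append
    h2 hb).append h4.reverse ha.symm).append h3 hg.symm) hl.symm ?_
  rw [C.seg_append (i := s) (j := j + 1) (k := s + C.n) (by omega) (by omega),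
    C.seg_append (i := j + 1) (j := j + 2) (k := s + C.n) (by omega) (by omega),
    C.seg_append (i := j + 2) (j := l + 1) (k := s + C.n) (by omega) (by omega)]
  classical
  rw [List.perm_iff_count]; intro z
  simp [List.count_append, List.count_reverse, List.count_cons]; ring

/-- The longer cycle is `h`, `i` back to `s`, `j - 1` back to `i + 1`, `s - 1` back around to `j`.
In the next rule the middle arc is traversed forwards. -/
lemma not_adj_succ_pred {s i j : ℤ} (hsi : s ≤ i) (hij : i + 2 ≤ j) (hjs : j < s + C.n)
    (hi : Γ.Adj h (C.c i)) (hj : Γ.Adj h (C.c j))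
    (ha : Γ.Adj (C.c (s - 1)) (C.c (i + 1))) (hb : Γ.Adj (C.c s) (C.c (j - 1))) : False := by
  have h1 := C.pathList_seg (i := s) (j := i + 1) (e := i) rfl (by omega)
  have h2 := C.pathList_seg (i := i + 1) (j := j) (e := j - 1) (by ring) (by omega)
  have h3 := C.pathList_seg (i := j) (j := s + C.n) (e := s + C.n - 1) (by ring) (by omega)
  rw [C.c_pred] at h3
  refine C.not_cons_perm hh (s := s) ((((PathList.singleton Γ h).append h1.reverse hi).append
    h2.reverse hb).append h3.reverse ha.symm) hj.symm ?_
  rw [C.seg_append (i := s) (j := i + 1) (k := s + C.n) (by omega) (by omega),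
    C.seg_append (i := i + 1) (j := j) (k := s + C.n) (by omega) (by omega)]
  classical
  rw [List.perm_iff_count]; intro z
  simp [List.count_append, List.count_reverse, List.count_cons]

lemma not_adj_pred_succ {s i j : ℤ} (hsi : s ≤ i) (hij : i + 2 ≤ j) (hjs : j < s + C.n)
    (hi : Γ.Adj h (C.c i)) (hj : Γ.Adj h (C.c j))
    (hb : Γ.Adj (C.c s) (C.c (i + 1))) (ha : Γ.Adj (C.c (s - 1)) (C.c (j - 1))) : False := by
  have h1 := C.pathList_seg (i := s) (j := i + 1) (e := i) rfl (by omega)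
  have h2 := C.pathList_seg (i := i + 1) (j := j) (e := j - 1) (by ring) (by omega)
  have h3 := C.pathList_seg (i := j) (j := s + C.n) (e := s + C.n - 1) (by ring) (by omega)
  rw [C.c_pred] at h3
  refine C.not_cons_perm hh (s := s) ((((PathList.singleton Γ h).append h1.reverse hi).append
    h2 hb).append h3.reverse ha.symm) hj.symm ?_
  rw [C.seg_append (i := s) (j := i + 1) (k := s + C.n) (by omega) (by omega),
    C.seg_append (i := i + 1) (j := j) (k := s + C.n) (by omega) (by omega)]
  classical
  rw [List.perm_iff_count]; intro z
  simp [List.count_append, List.count_reverse, List.count_cons]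

/-- All three arcs keep their direction: `h`, `s` to `i`, `j + 1` around to `s - 1`, `i + 1` to `j`.
-/
lemma not_adj_chord {s i j : ℤ} (hsi : s ≤ i) (hij : i < j) (hjs : j + 1 < s + C.n)
    (hs : Γ.Adj h (C.c s)) (hj : Γ.Adj h (C.c j))
    (ha : Γ.Adj (C.c (s - 1)) (C.c (i + 1))) (hb : Γ.Adj (C.c i) (C.c (j + 1))) : False := by
  have h1 := C.pathList_seg (i := s) (j := i + 1) (e := i) rfl (by omega)
  have h2 := C.pathList_seg (i := i + 1) (j := j + 1) (e := j) rfl (by omega)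
  have h3 := C.pathList_seg (i := j + 1) (j := s + C.n) (e := s + C.n - 1) (by ring) (by omega)
  rw [C.c_pred] at h3
  refine C.not_cons_perm hh (s := s) ((((PathList.singleton Γ h).append h1 hs).append
    h3 hb).append h2 ha) hj.symm ?_
  rw [C.seg_append (i := s) (j := i + 1) (k := s + C.n) (by omega) (by omega),
    C.seg_append (i := i + 1) (j := j + 1) (k := s + C.n) (by omega) (by omega)]
  classical
  rw [List.perm_iff_count]; intro z
  simp [List.count_append, List.count_cons]; ring

end Rules

/-- The same cycle, traversed backwards. -/
def rev : LongestCycle Γ ω where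
  n := C.n
  c i := C.c (-i)
  periodic i := by rw [← C.periodic (-(i + C.n))]; congr 1; ring
  inj i j h := by
    have := C.inj _ _ h
    rwa [← dvd_neg, show -(i - j) = -i - -j by ring]
  adj i := by
    have := C.adj (-(i + 1))
    rw [show -(i + 1) + 1 = -i by ring] at this
    exact this.symm
  three_le := C.three_le
  exists_eq := by
    obtain ⟨i, hi⟩ := C.exists_eq
    exact ⟨-i, by simpa using hi⟩
  length_le := C.length_le

end LongestCycle

end SimpleGraph

/-! ### Junctions: the neighbours of a missed vertex along the cycle. -/

namespace SimpleGraph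

variable {X : Type*}

/-- A longest cycle through `ω` avoiding a vertex `h`, with the neighbours of `h` organised in
`m` cyclically ordered junctions: the positions `q j ≤ p j` bound the `j`-th junction, and they
differ for at most one junction, the one containing `ω`. The graph without `ω` is
`(K₂ ∪ kK₁)`-free with small independent sets and large minimum degree. -/
structure Junctions [Fintype X] (Γ : SimpleGraph X) (ω : X) (k : ℕ) extends LongestCycle Γ ω where
  h : X
  off : ∀ i, c i ≠ h
  m : ℕ
  p : ℤ → ℤ
  q : ℤ → ℤ
  p_add : ∀ j, p (j + m) = p j + n
  q_add : ∀ j, q (j + m) = q j + n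
  q_le : ∀ j, q j ≤ p j
  p_add_two_le : ∀ j, p j + 2 ≤ q (j + 1)
  q_eq : ∀ j, ¬ (m : ℤ) ∣ j → q j = p j
  adj_p : ∀ j, Γ.Adj h (c (p j))
  adj_q : ∀ j, Γ.Adj h (c (q j))
  of_adj : ∀ t, Γ.Adj h (c t) → ∃ j, t = p j ∨ t = q j
  ne_omega : ∀ j t, p j ≤ t → t ≤ q (j + 1) → c t ≠ ω
  indep_off : ∀ z z', (∀ i, c i ≠ z) → (∀ i, c i ≠ z') → ¬ Γ.Adj z z'
  free : ∀ a b, a ≠ ω → b ≠ ω → Γ.Adj a b → ∀ I : Finset X, ω ∉ I →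
    (∀ x ∈ I, ∀ y ∈ I, ¬ Γ.Adj x y) → (∀ x ∈ I, ¬ Γ.Adj a x ∧ ¬ Γ.Adj b x) → I.card < k
  card_lt : ∀ I : Finset X, ω ∉ I → (∀ x ∈ I, ∀ y ∈ I, ¬ Γ.Adj x y) →
    2 * I.card + 1 < Fintype.card X
  le_degree : ∀ v, v ≠ ω → ∀ S : Finset X, (∀ f, f ≠ ω → Γ.Adj v f → f ∈ S) →
    3 * k ≤ 2 * S.card + 1
  two_le : 2 ≤ k
  k_le : k ≤ m
  le_m : 3 * k ≤ 2 * m + 3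

namespace Junctions

variable [Fintype X] {Γ : SimpleGraph X} {ω : X} {k : ℕ} (C : Junctions Γ ω k)

/-- The successor of the `j`-th junction. -/
def w (j : ℤ) : X := C.c (C.p j + 1)

/-- The predecessor of the `j`-th junction. -/
def u (j : ℤ) : X := C.c (C.q j - 1)

/-- The same configuration, traversed backwards. -/
def rev : Junctions Γ ω k where
  __ := C.toLongestCycle.rev
  h := C.h
  off i := C.off _
  m := C.m
  p j := - C.q (-j)
  q j := - C.p (-j)
  p_add j := by
    have := C.q_add (-(j + C.m))
    rw [show -(j + C.m) + C.m = -j by ring] at this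
    change _ = - C.q (-j) + C.n
    omega
  q_add j := by
    have := C.p_add (-(j + C.m))
    rw [show -(j + C.m) + C.m = -j by ring] at this
    change _ = - C.p (-j) + C.n
    omega
  q_le j := by have := C.q_le (-j); omega
  p_add_two_le j := by
    have := C.p_add_two_le (-(j + 1))
    rw [show -(j + 1) + 1 = -j by ring] at this
    omega
  q_eq j hj := by rw [C.q_eq (-j) (by rwa [dvd_neg])]
  adj_p j := by
    change Γ.Adj C.h (C.c (- - C.q (-j)))
    rw [neg_neg]; exact C.adj_q _
  adj_q j := by
    change Γ.Adj C.h (C.c (- - C.p (-j)))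
    rw [neg_neg]; exact C.adj_p _
  of_adj t ht := by
    obtain ⟨j, hj⟩ := C.of_adj (-t) ht
    refine ⟨-j, ?_⟩
    rw [neg_neg]; omega
  ne_omega j t h1 h2 := by
    refine C.ne_omega (-(j + 1)) (-t) (by omega) ?_
    rw [show -(j + 1) + 1 = -j by ring]
    omega
  indep_off z z' h h' := C.indep_off z z' (fun i => by
    have := h (-i); change C.c (- -i) ≠ z at this; rwa [neg_neg] at this)
    (fun i => by
    have := h' (-i); change C.c (- -i) ≠ z' at this; rwa [neg_neg] at this)
  free := C.free
  card_lt := C.card_lt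
  le_degree := C.le_degree
  two_le := C.two_le
  k_le := C.k_le
  le_m := C.le_m

lemma rev_w (j : ℤ) : C.rev.w j = C.u (-j) := by
  change C.c (-(-C.q (-j) + 1)) = _
  rw [u]; congr 1; ring

lemma rev_u (j : ℤ) : C.rev.u j = C.w (-j) := by
  change C.c (-(-C.p (-j) - 1)) = _
  rw [w]; congr 1; ring

lemma m_pos : 0 < C.m := by have := C.k_le; have := C.two_le; omega

lemma p_lt_succ (j : ℤ) : C.p j + 2 ≤ C.p (j + 1) :=
  (C.p_add_two_le j).trans (C.q_le _)

lemma p_strictMono : StrictMono C.p :=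
  strictMono_int_of_lt_succ fun j => by have := C.p_lt_succ j; omega

lemma p_lt_q {i j : ℤ} (h : i < j) : C.p i + 2 ≤ C.q j := by
  have h1 := C.p_add_two_le (j - 1)
  rw [sub_add_cancel] at h1
  have := C.p_strictMono.monotone (show i ≤ j - 1 by omega)
  omega

lemma p_add_mul (j a : ℤ) : C.p (j + a * C.m) = C.p j + a * C.n := by
  induction a with
  | zero => simp
  | succ a ih => rw [add_mul, one_mul, ← add_assoc, C.p_add, ih]; ring
  | pred a ih =>
    have := C.p_add (j + (-a - 1) * C.m)
    rw [show j + (-a - 1) * C.m + C.m = j + -a * C.m by ring, ih] at this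
    linarith

lemma q_add_mul (j a : ℤ) : C.q (j + a * C.m) = C.q j + a * C.n := by
  induction a with
  | zero => simp
  | succ a ih => rw [add_mul, one_mul, ← add_assoc, C.q_add, ih]; ring
  | pred a ih =>
    have := C.q_add (j + (-a - 1) * C.m)
    rw [show j + (-a - 1) * C.m + C.m = j + -a * C.m by ring, ih] at this
    linarith

lemma w_add_mul (j a : ℤ) : C.w (j + a * C.m) = C.w j := by
  rw [w, w, p_add_mul, ← C.periodic_mul (C.p j + 1) a]; congr 1; ring

lemma u_add_mul (j a : ℤ) : C.u (j + a * C.m) = C.u j := by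
  rw [u, u, q_add_mul, ← C.periodic_mul (C.q j - 1) a]; congr 1; ring

lemma w_add (j : ℤ) : C.w (j + C.m) = C.w j := by simpa using C.w_add_mul j 1

lemma u_add (j : ℤ) : C.u (j + C.m) = C.u j := by simpa using C.u_add_mul j 1

lemma exists_add_mul (i j : ℤ) : ∃ a : ℤ, i ≤ j + a * C.m ∧ j + a * C.m < i + C.m := by
  have hm : (0 : ℤ) < C.m := by exact_mod_cast C.m_pos
  refine ⟨-((j - i) / C.m), ?_, ?_⟩
  · have := Int.emod_nonneg (j - i) hm.ne'
    have := Int.emod_add_mul_ediv (j - i) C.m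
    linarith
  · have := Int.emod_lt_of_pos (j - i) hm
    have := Int.emod_add_mul_ediv (j - i) C.m
    linarith

lemma exists_p (s : ℤ) : ∃ i, C.p (i - 1) < s ∧ s ≤ C.p i := by
  have hn : (0 : ℤ) < C.n := by exact_mod_cast C.n_pos
  have hbdd : ∃ b, ∀ z, C.p z < s → z ≤ b := by
    refine ⟨(|s| + |C.p 0|) * C.m, fun z hz => ?_⟩
    by_contra hlt
    have h1 := C.p_strictMono (not_le.1 hlt)
    have h2 := C.p_add_mul 0 (|s| + |C.p 0|)
    rw [zero_add] at h2
    have h3 := le_abs_self s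
    have h4 := neg_abs_le (C.p 0)
    have h5 : (|s| + |C.p 0|) * 1 ≤ (|s| + |C.p 0|) * C.n :=
      mul_le_mul_of_nonneg_left (by omega) (by positivity)
    omega
  have hne : ∃ z, C.p z < s := by
    refine ⟨-(|s| + |C.p 0| + 1) * C.m, ?_⟩
    have h2 := C.p_add_mul 0 (-(|s| + |C.p 0| + 1))
    rw [zero_add] at h2
    have h3 := neg_abs_le s
    have h4 := le_abs_self (C.p 0)
    have h5 : (|s| + |C.p 0| + 1) * 1 ≤ (|s| + |C.p 0| + 1) * C.n :=
      mul_le_mul_of_nonneg_left (by omega) (by positivity)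
    have h6 : -(|s| + |C.p 0| + 1) * (C.n : ℤ) = -((|s| + |C.p 0| + 1) * C.n) := by ring
    omega
  obtain ⟨i, hi, hmax⟩ := Int.exists_greatest_of_bdd hbdd hne
  refine ⟨i + 1, by simpa using hi, ?_⟩
  by_contra h
  have := hmax (i + 1) (by omega)
  omega

lemma p_lt_add_n {i j : ℤ} (h : j < i + C.m) : C.p j < C.p i + C.n := by
  have := C.p_strictMono h
  rwa [C.p_add] at this

lemma w_inj {i j : ℤ} (h : C.w i = C.w j) (h1 : i < j + C.m) (h2 : j < i + C.m) : i = j := by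
  have := C.eq_of_c_eq h (by have := C.p_lt_add_n h1; omega) (by have := C.p_lt_add_n h2; omega)
  exact C.p_strictMono.injective (by omega)

lemma w_injOn (i : ℤ) : Set.InjOn C.w (Set.Ico i (i + C.m)) := by
  intro a ha b hb hab
  simp only [Set.mem_Ico] at ha hb
  exact C.w_inj hab (by omega) (by omega)

lemma w_ne_omega (j : ℤ) : C.w j ≠ ω :=
  C.ne_omega j _ (by omega) (by have := C.p_add_two_le j; omega)

lemma u_ne_omega (j : ℤ) : C.u j ≠ ω := by
  have := C.rev.w_ne_omega (-j)
  rwa [rev_w, neg_neg] at this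

lemma h_ne_omega : C.h ≠ ω := by
  obtain ⟨i, hi⟩ := C.exists_eq
  exact fun h => C.off i (hi.trans h.symm)

lemma w_ne_h (j : ℤ) : C.w j ≠ C.h := C.off _

lemma u_ne_h (j : ℤ) : C.u j ≠ C.h := C.off _

lemma not_adj_succ {s t : ℤ} (hs : Γ.Adj C.h (C.c s)) (ht : Γ.Adj C.h (C.c t)) :
    ¬ Γ.Adj (C.c (s + 1)) (C.c (t + 1)) := by
  obtain ⟨r, h1, h2, h3, h4⟩ := C.exists_mem_Ico t s
  have h5 : C.c (t + 1) = C.c (r + 1) := by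
    obtain ⟨a, ha⟩ := h4
    rw [← C.periodic_mul (r + 1) a]; congr 1; linarith
  rw [h5]
  rcases h1.eq_or_lt with rfl | h1
  · exact Γ.irrefl
  · exact C.not_adj_succ_succ (PathList.singleton Γ C.h) (by simp) (by simpa using C.off) h1 h2
      hs (h3 ▸ ht)

lemma not_adj_w_w (i j : ℤ) : ¬ Γ.Adj (C.w i) (C.w j) := C.not_adj_succ (C.adj_p i) (C.adj_p j)

lemma not_adj_u_u (i j : ℤ) : ¬ Γ.Adj (C.u i) (C.u j) := by
  have := C.rev.not_adj_w_w (-i) (-j)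
  rwa [rev_w, rev_w, neg_neg, neg_neg] at this

lemma not_adj_h_succ {t : ℤ} (ht : Γ.Adj C.h (C.c t)) : ¬ Γ.Adj C.h (C.c (t + 1)) :=
  C.not_adj_of_adj (PathList.singleton Γ C.h) (by simp) (by simpa using C.off) ht

lemma not_adj_h_w (j : ℤ) : ¬ Γ.Adj C.h (C.w j) := C.not_adj_h_succ (C.adj_p j)

lemma not_adj_h_u (j : ℤ) : ¬ Γ.Adj C.h (C.u j) := by
  have := C.rev.not_adj_h_w (-j)
  rwa [rev_w, neg_neg] at this

section

variable [DecidableEq X]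

lemma card_insert_image_w {i : ℤ} {T : Finset ℤ} (hT : ∀ t ∈ T, i ≤ t ∧ t < i + C.m) :
    (insert C.h (T.image C.w)).card = T.card + 1 := by
  rw [Finset.card_insert_of_notMem, Finset.card_image_of_injOn]
  · exact (C.w_injOn i).mono fun t ht => hT t ht
  · simp only [Finset.mem_image, not_exists, not_and]
    exact fun t _ => C.w_ne_h t

lemma indep_insert_image_w (T : Finset ℤ) :
    ∀ x ∈ insert C.h (T.image C.w), ∀ y ∈ insert C.h (T.image C.w), ¬ Γ.Adj x y := by
  simp only [Finset.mem_insert, Finset.mem_image]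
  rintro x (rfl | ⟨i, -, rfl⟩) y (rfl | ⟨j, -, rfl⟩)
  · exact Γ.irrefl
  · exact C.not_adj_h_w j
  · exact fun h => C.not_adj_h_w i h.symm
  · exact C.not_adj_w_w i j

lemma omega_notMem_insert_image_w (T : Finset ℤ) : ω ∉ insert C.h (T.image C.w) := by
  simp only [Finset.mem_insert, Finset.mem_image, not_or, not_exists, not_and]
  exact ⟨C.h_ne_omega.symm, fun t _ => C.w_ne_omega t⟩

/-- Adjacent vertices have few common non-neighbours among the `w j`. -/
lemma card_add_one_lt {a b : X} (ha : a ≠ ω) (hb : b ≠ ω) (hab : Γ.Adj a b) {i : ℤ} {T : Finset ℤ}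
    (hT : ∀ t ∈ T, i ≤ t ∧ t < i + C.m) (hah : ¬ Γ.Adj a C.h) (hbh : ¬ Γ.Adj b C.h)
    (haT : ∀ t ∈ T, ¬ Γ.Adj a (C.w t)) (hbT : ∀ t ∈ T, ¬ Γ.Adj b (C.w t)) : T.card + 1 < k := by
  rw [← C.card_insert_image_w hT]
  refine C.free a b ha hb hab _ (C.omega_notMem_insert_image_w T) (C.indep_insert_image_w T) ?_
  simp only [Finset.mem_insert, Finset.mem_image]
  rintro x (rfl | ⟨i, hi, rfl⟩)
  · exact ⟨hah, hbh⟩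
  · exact ⟨haT i hi, hbT i hi⟩

end

/-- By `not_adj_two`, `z` can be adjacent to only one of the w's. An edge from `z` to `w j` would
then have `h` and the other m - 1 w's as common non-neighbours, which is m ≥ k vertices. -/
lemma not_adj_off_w {z : X} (hz : ∀ i, C.c i ≠ z) (j : ℤ) : ¬ Γ.Adj z (C.w j) := by
  classical
  intro hzj
  rcases eq_or_ne z C.h with rfl | hzh
  · exact C.not_adj_h_w j hzj
  have h1 : z ≠ ω := by
    obtain ⟨i, hi⟩ := C.exists_eq
    rw [← hi]; exact (hz i).symm
  have h2 := C.card_add_one_lt h1 (C.w_ne_omega j) hzj (i := j) (T := Finset.Ioo j (j + C.m))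
    (fun t ht => by rw [Finset.mem_Ioo] at ht; omega) (C.indep_off _ _ hz C.off)
    (fun h => C.not_adj_h_w j h.symm) ?_ (fun t _ => C.not_adj_w_w _ _)
  · rw [Int.card_Ioo] at h2
    have := C.k_le; have := C.two_le
    omega
  · intro t ht hzt
    rw [Finset.mem_Ioo] at ht
    exact C.not_adj_two C.off hz hzh (C.p_strictMono ht.1) (C.p_lt_add_n ht.2) (C.adj_p j)
      (C.adj_p t) hzj hzt

/-! ### The independent set J and the order of neighbours across a cut. -/

open Classical in
/-- The vertices without neighbours among the `w j` and the vertices off the cycle. -/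
noncomputable def J : Finset X :=
  {v | v ≠ ω ∧ (∀ j, ¬ Γ.Adj v (C.w j)) ∧ ∀ z, (∀ i, C.c i ≠ z) → ¬ Γ.Adj v z}

lemma mem_J {v : X} : v ∈ C.J ↔
    v ≠ ω ∧ (∀ j, ¬ Γ.Adj v (C.w j)) ∧ ∀ z, (∀ i, C.c i ≠ z) → ¬ Γ.Adj v z := by
  simp [J]

lemma w_mem_J (j : ℤ) : C.w j ∈ C.J :=
  C.mem_J.2 ⟨C.w_ne_omega j, C.not_adj_w_w j, fun _ hz h => C.not_adj_off_w hz j h.symm⟩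

lemma off_mem_J {z : X} (hz : ∀ i, C.c i ≠ z) : z ∈ C.J := by
  refine C.mem_J.2 ⟨?_, C.not_adj_off_w hz, fun z' hz' => C.indep_off _ _ hz hz'⟩
  obtain ⟨i, hi⟩ := C.exists_eq
  rw [← hi]; exact (hz i).symm

lemma h_mem_J : C.h ∈ C.J := C.off_mem_J C.off

lemma ne_omega_of_mem_J {v : X} (hv : v ∈ C.J) : v ≠ ω := (C.mem_J.1 hv).1

/-- An edge inside J would have `h` and all the w's as common non-neighbours. -/
lemma J_indep : ∀ x ∈ C.J, ∀ y ∈ C.J, ¬ Γ.Adj x y := by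
  classical
  intro x hx y hy hxy
  rw [mem_J] at hx hy
  have := C.card_add_one_lt hx.1 hy.1 hxy (i := 0) (T := Finset.Ico 0 (0 + C.m))
    (fun t ht => by simpa using ht) (hx.2.2 _ C.off) (hy.2.2 _ C.off) (fun t _ => hx.2.1 t)
    (fun t _ => hy.2.1 t)
  rw [Int.card_Ico] at this
  have := C.k_le
  omega

/-- A vertex outside `J` has fewer than `k` non-neighbours in `J`. -/
lemma card_lt_of_notMem {v : X} (hv : v ∉ C.J) (hω : v ≠ ω) {S : Finset X} (hS : S ⊆ C.J)
    (hvS : ∀ x ∈ S, ¬ Γ.Adj v x) : S.card < k := by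
  obtain ⟨y, hy, hvy⟩ : ∃ y ∈ C.J, Γ.Adj v y := by
    by_contra! hcon
    exact hv (C.mem_J.2 ⟨hω, fun j => hcon _ (C.w_mem_J j), fun z hz => hcon _ (C.off_mem_J hz)⟩)
  refine C.free v y hω (C.ne_omega_of_mem_J hy) hvy S
    (fun h => C.ne_omega_of_mem_J (hS h) rfl)
    (fun x hx z hz => C.J_indep x (hS hx) z (hS hz)) fun x hx => ⟨hvS x hx, C.J_indep y hy x (hS hx)⟩

lemma card_w_lt {v : X} (hv : v ∉ C.J) (hω : v ≠ ω) {i : ℤ} {T : Finset ℤ}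
    (hT : ∀ t ∈ T, i ≤ t ∧ t < i + C.m) (hvT : ∀ t ∈ T, ¬ Γ.Adj v (C.w t)) : T.card < k := by
  classical
  rw [← Finset.card_image_of_injOn (s := T) (f := C.w)
    ((C.w_injOn i).mono fun t ht => hT t ht)]
  refine C.card_lt_of_notMem hv hω ?_ ?_
  · intro x hx
    obtain ⟨t, -, rfl⟩ := Finset.mem_image.1 hx
    exact C.w_mem_J t
  · intro x hx
    obtain ⟨t, ht, rfl⟩ := Finset.mem_image.1 hx
    exact hvT t ht

lemma card_w_add_one_lt {v : X} (hv : v ∉ C.J) (hω : v ≠ ω) (hvh : ¬ Γ.Adj v C.h) {i : ℤ}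
    {T : Finset ℤ} (hT : ∀ t ∈ T, i ≤ t ∧ t < i + C.m) (hvT : ∀ t ∈ T, ¬ Γ.Adj v (C.w t)) :
    T.card + 1 < k := by
  classical
  rw [← C.card_insert_image_w hT]
  refine C.card_lt_of_notMem hv hω ?_ ?_
  · intro x hx
    simp only [Finset.mem_insert, Finset.mem_image] at hx
    rcases hx with rfl | ⟨t, -, rfl⟩
    · exact C.h_mem_J
    · exact C.w_mem_J t
  · intro x hx
    simp only [Finset.mem_insert, Finset.mem_image] at hx
    rcases hx with rfl | ⟨t, ht, rfl⟩
    · exact hvh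
    · exact hvT t ht

open Classical in
/-- The indices `j` in the period starting at `i` with `v` adjacent to `w j`. -/
noncomputable def nbrs (v : X) (i : ℤ) : Finset ℤ :=
  {j ∈ Finset.Ico i (i + C.m) | Γ.Adj v (C.w j)}

lemma mem_nbrs {v : X} {i j : ℤ} :
    j ∈ C.nbrs v i ↔ (i ≤ j ∧ j < i + C.m) ∧ Γ.Adj v (C.w j) := by
  simp [nbrs]

lemma le_card_nbrs {v : X} (hv : v ∉ C.J) (hω : v ≠ ω) (i : ℤ) :
    C.m + 1 ≤ k + (C.nbrs v i).card := by
  classical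
  have h1 := C.card_w_lt hv hω (i := i) (T := {j ∈ Finset.Ico i (i + C.m) | ¬ Γ.Adj v (C.w j)})
    (fun t ht => by simp at ht; exact ht.1) (fun t ht => by simp at ht; exact ht.2)
  have h2 := Finset.card_filter_add_card_filter_not (s := Finset.Ico i (i + C.m))
    (fun j => Γ.Adj v (C.w j))
  rw [Int.card_Ico] at h2
  rw [nbrs]
  omega

lemma le_card_nbrs' {v : X} (hv : v ∉ C.J) (hω : v ≠ ω) (hvh : ¬ Γ.Adj v C.h) (i : ℤ) :
    C.m + 2 ≤ k + (C.nbrs v i).card := by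
  classical
  have h1 := C.card_w_add_one_lt hv hω hvh (i := i)
    (T := {j ∈ Finset.Ico i (i + C.m) | ¬ Γ.Adj v (C.w j)})
    (fun t ht => by simp at ht; exact ht.1) (fun t ht => by simp at ht; exact ht.2)
  have h2 := Finset.card_filter_add_card_filter_not (s := Finset.Ico i (i + C.m))
    (fun j => Γ.Adj v (C.w j))
  rw [Int.card_Ico] at h2
  rw [nbrs]
  omega

/-- This vertex misses `h` and every w, too many members of J for a vertex outside J. The case of
interest is the inner side of the long junction, where it need not be a w. -/
lemma succ_mem_J {t : ℤ} (ht : Γ.Adj C.h (C.c t)) (hω : C.c (t + 1) ≠ ω) :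
    C.c (t + 1) ∈ C.J := by
  by_contra hJ
  have := C.card_w_add_one_lt hJ hω (fun h => C.not_adj_h_succ ht h.symm) (i := 0)
    (T := Finset.Ico 0 (0 + C.m)) (fun t ht => by simpa using ht)
    (fun j _ => C.not_adj_succ ht (C.adj_p j))
  rw [Int.card_Ico] at this
  have := C.k_le
  omega

/-- The neighbours of the two ends of a cut among the `w j` are separated. -/
lemma lt_of_adj_cut {s i j l : ℤ} (h1 : C.p (i - 1) + 1 < s) (h2 : s ≤ C.p i)
    (hj : i ≤ j) (hj' : j < i + C.m) (hl : i ≤ l) (hl' : l < i + C.m)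
    (ha : Γ.Adj (C.c (s - 1)) (C.w j)) (hb : Γ.Adj (C.c s) (C.w l)) : l < j := by
  classical
  have key : ∀ t, t < i + C.m → C.p t + 1 < s + C.n := by
    intro t ht
    have h3 := C.p_strictMono.monotone (show t ≤ i - 1 + C.m by omega)
    rw [C.p_add] at h3
    omega
  have mono := C.p_strictMono.monotone
  by_contra hlt
  rcases (not_lt.1 hlt).lt_or_eq with hlt | rfl
  · exact C.not_adj_cut C.off (h2.trans (mono hj)) (C.p_strictMono hlt) (key l hl') (C.adj_p j)
      (C.adj_p l) ha hb
  -- A common neighbour `w j` of both ends could be inserted into the cut edge.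
  · have hsj : s ≤ C.p j := h2.trans (mono hj)
    have hjs : C.p j + 2 < s + C.n := by
      rcases (show C.p j + 2 ≤ s + C.n by have := key j hj'; omega).lt_or_eq with h | h
      · exact h
      · exfalso
        rw [← C.c_pred, ← h, w, show C.p j + 2 - 1 = C.p j + 1 by ring] at ha
        exact Γ.irrefl ha
    have hq := C.p_add_two_le j
    have hgw : Γ.Adj (C.c (C.p j + 2)) (C.w j) := by
      have := C.adj (C.p j + 1)
      rw [show C.p j + 1 + 1 = C.p j + 2 by ring] at this
      exact this.symm
    -- The insertion rules make `h` and the other m - 1 w's common non-neighbours of the edge from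
    -- `w j` to its successor.
    have h3 := C.card_add_one_lt (C.ne_omega j _ (by omega) hq) (C.w_ne_omega j) hgw (i := i)
      (T := (Finset.Ico i (i + C.m)).erase j) (fun t ht => by simp at ht; exact ht.2)
      (fun hg => C.not_adj_insert_self C.off hsj hjs (C.adj_p j) ha hb hg.symm)
      (fun hg => C.not_adj_h_w j hg.symm) ?_ (fun t _ => C.not_adj_w_w _ _)
    · rw [Finset.card_erase_of_mem (by simp; omega), Int.card_Ico] at h3
      have := C.k_le
      omega
    · intro t ht hg
      simp only [Finset.mem_erase, Finset.mem_Ico] at ht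
      rcases lt_or_gt_of_ne ht.1 with h | h
      · exact C.not_adj_insert_lt C.off (h2.trans (mono ht.2.1)) (C.p_strictMono h) hjs
          (C.adj_p t) (C.adj_p j) ha hb hg
      · exact C.not_adj_insert_gt C.off hsj
          ((C.p_lt_succ j).trans (mono (show j + 1 ≤ t by omega))) (key t ht.2.2)
          (C.adj_p j) (C.adj_p t) ha hb hg

/-- Two consecutive vertices of the cycle lie outside `J`. -/
lemma exists_notMem : ∃ s, C.c (s - 1) ∉ C.J ∧ C.c s ∉ C.J ∧ C.c (s - 1) ≠ ω ∧ C.c s ≠ ω := by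
  classical
  by_contra! hcon
  have hmap : ∀ v ∈ (insert ω C.J)ᶜ, ∃ t, C.c t = v := by
    intro v hv
    by_contra! h
    simp only [Finset.mem_compl, Finset.mem_insert, not_or] at hv
    exact hv.2 (C.off_mem_J h)
  choose! f hf using hmap
  -- If no such pair exists, the successor map injects the vertices outside J ∪ {ω} into J ∪ {ω}
  -- without `h`. This makes J too large for the bound on independent sets.
  have h1 : ((insert ω C.J)ᶜ).card ≤ (insert ω (C.J.erase C.h)).card := by
    refine Finset.card_le_card_of_injOn (fun v => C.c (f v + 1)) ?_ ?_
    · intro v hv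
      have h2 := hf v hv
      simp only [Finset.coe_compl, Set.mem_compl_iff, Finset.mem_coe, Finset.mem_insert,
        not_or] at hv
      have h3 := hcon (f v + 1)
      rw [add_sub_cancel_right, h2] at h3
      simp only [Finset.coe_insert, Set.mem_insert_iff, Finset.mem_coe, Finset.mem_erase]
      by_cases h4 : C.c (f v + 1) = ω
      · exact Or.inl h4
      · refine Or.inr ⟨C.off _, ?_⟩
        by_contra h5
        exact h4 (h3 hv.2 h5 hv.1)
    · intro v hv v' hv' hvv
      have h2 := C.inj _ _ hvv
      rw [← hf v hv, ← hf v' hv']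
      obtain ⟨a, ha⟩ := h2
      rw [← C.periodic_mul (f v') a]; congr 1; linarith
  have hω : ω ∉ C.J := fun h => C.ne_omega_of_mem_J h rfl
  rw [Finset.card_compl, Finset.card_insert_of_notMem hω, Finset.card_insert_of_notMem
    (fun h => hω (Finset.mem_of_mem_erase h)), Finset.card_erase_of_mem C.h_mem_J] at h1
  have h2 := C.card_lt C.J hω C.J_indep
  have := Finset.card_pos.2 ⟨_, C.h_mem_J⟩
  omega

end Junctions

end SimpleGraph

/-! ### Counting in windows of m indices, which forces m = k. -/

namespace SimpleGraph

variable {X : Type*}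

namespace Junctions

variable [Fintype X] {Γ : SimpleGraph X} {ω : X} {k : ℕ} (C : Junctions Γ ω k)

lemma q_strictMono : StrictMono C.q :=
  strictMono_int_of_lt_succ fun j => by
    have := C.p_add_two_le j; have := C.q_le j; omega

lemma u_inj {i j : ℤ} (h : C.u i = C.u j) (h1 : i < j + C.m) (h2 : j < i + C.m) : i = j := by
  have h3 : C.rev.w (-i) = C.rev.w (-j) := by rwa [rev_w, rev_w, neg_neg, neg_neg]
  have h4 : C.rev.m = C.m := rfl
  have := C.rev.w_inj h3 (by rw [h4]; omega) (by rw [h4]; omega)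
  omega

lemma u_injOn (i : ℤ) : Set.InjOn C.u (Set.Ico i (i + C.m)) := by
  intro a ha b hb hab
  simp only [Set.mem_Ico] at ha hb
  exact C.u_inj hab (by omega) (by omega)

lemma w_ne_u {i j : ℤ} (h1 : i + 1 < j) (h2 : j ≤ i + C.m) : C.w i ≠ C.u j := by
  intro h
  have h3 := C.p_lt_q (show i + 1 < j from h1)
  have h4 := C.p_strictMono (show i < i + 1 by omega)
  have h5 := C.p_strictMono.monotone h2
  rw [C.p_add] at h5
  have h6 := C.q_le j
  have := C.eq_of_c_eq h (by omega) (by omega)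
  omega

lemma q_notMem_J (i : ℤ) : C.c (C.q i) ∉ C.J := fun h =>
  C.J_indep _ C.h_mem_J _ h (C.adj_q i)

lemma q_ne_omega (i : ℤ) : C.c (C.q i) ≠ ω := by
  have h := C.p_add_two_le (i - 1)
  have h2 := C.ne_omega (i - 1) (C.q i) (by rw [sub_add_cancel] at h; omega)
  exact h2 (by rw [sub_add_cancel])

/-- If all u's were in J, take a cut edge with both ends outside J. The u-neighbours of its first
end, the w-neighbours of its second end and the w-neighbours of its first end come in this order;
only the first two sets can share an index, and at most one. Their sizes are at least m + 2 - k, m +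
1 - k and m + 2 - k, which do not fit into m indices. -/
lemma exists_u_notMem : ∃ i, C.u i ∉ C.J := by
  classical
  by_contra! hu
  obtain ⟨s, ha, hb, haω, hbω⟩ := C.exists_notMem
  obtain ⟨i, h1, h2⟩ := C.exists_p s
  have h1' : C.p (i - 1) + 1 < s := by
    rcases (show C.p (i - 1) + 1 ≤ s by omega).lt_or_eq with h | h
    · exact h
    · exact absurd (C.w_mem_J (i - 1)) (by rwa [w, h])
  have hah : ¬ Γ.Adj (C.c (s - 1)) C.h := fun h => by
    have := C.succ_mem_J h.symm
    rw [sub_add_cancel] at this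
    exact hb (this hbω)
  have hA := C.le_card_nbrs' ha haω hah i
  have hB := C.le_card_nbrs hb hbω i
  set A := C.nbrs (C.c (s - 1)) i
  set B := C.nbrs (C.c s) i
  set T : Finset ℤ := {j ∈ Finset.Ico i (i + C.m) | ¬ Γ.Adj (C.c (s - 1)) (C.u j)} with hT
  set A' : Finset ℤ := {j ∈ Finset.Ico i (i + C.m) | Γ.Adj (C.c (s - 1)) (C.u j)} with hA'
  have h3 : A'.card + T.card = C.m := by
    rw [hA', hT, Finset.card_filter_add_card_filter_not, Int.card_Ico]; omega
  have h4 : T.card + 1 < k := by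
    have : (insert C.h (T.image C.u)).card = T.card + 1 := by
      rw [Finset.card_insert_of_notMem, Finset.card_image_of_injOn]
      · exact (C.u_injOn i).mono fun t ht => by simp [hT] at ht; exact ht.1
      · simp only [Finset.mem_image, not_exists, not_and]
        exact fun t _ => C.u_ne_h t
    rw [← this]
    refine C.card_lt_of_notMem ha haω ?_ ?_
    · intro x hx
      simp only [Finset.mem_insert, Finset.mem_image] at hx
      rcases hx with rfl | ⟨t, -, rfl⟩
      · exact C.h_mem_J
      · exact hu t
    · intro x hx
      simp only [Finset.mem_insert, Finset.mem_image] at hx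
      rcases hx with rfl | ⟨t, ht, rfl⟩
      · exact hah
      · exact (Finset.mem_filter.1 ht).2
  have hBA : ∀ l ∈ B, ∀ j ∈ A, l < j := by
    intro l hl j hj
    rw [mem_nbrs] at hl hj
    exact C.lt_of_adj_cut h1' h2 hj.1.1 hj.1.2 hl.1.1 hl.1.2 hj.2 hl.2
  have hAB : ∀ j ∈ A', ∀ l ∈ B, j ≤ l := by
    intro j hj l hl
    simp only [hA', Finset.mem_filter, Finset.mem_Ico] at hj
    rw [mem_nbrs] at hl
    by_contra hlt
    have h5 := C.p_strictMono.monotone (show j ≤ i - 1 + C.m by omega)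
    rw [C.p_add] at h5
    have h6 := C.q_le j
    exact C.not_adj_pred_succ C.off (h2.trans (C.p_strictMono.monotone hl.1.1))
      (C.p_lt_q (not_le.1 hlt)) (by omega) (C.adj_p l) (C.adj_q j) hl.2 hj.2
  have hBne : B.Nonempty := Finset.card_pos.1 (by have := C.k_le; omega)
  have hmin := B.min'_mem hBne
  have hd1 : Disjoint (A'.erase (B.min' hBne)) B := by
    rw [Finset.disjoint_left]
    intro j hj hjB
    rw [Finset.mem_erase] at hj
    exact hj.1 (le_antisymm (hAB j hj.2 _ hmin) (B.min'_le j hjB))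
  have hd2 : Disjoint (A'.erase (B.min' hBne) ∪ B) A := by
    rw [Finset.disjoint_left]
    intro j hj hjA
    rcases Finset.mem_union.1 hj with hj | hj
    · have h5 := hAB j (Finset.mem_of_mem_erase hj) _ hmin
      have h6 := hBA _ hmin j hjA
      omega
    · exact (hBA j hj j hjA).false
  have hsub : A'.erase (B.min' hBne) ∪ B ∪ A ⊆ Finset.Ico i (i + C.m) := by
    refine Finset.union_subset (Finset.union_subset ?_ ?_) ?_
    · exact (Finset.erase_subset _ _).trans (Finset.filter_subset _ _)
    · exact Finset.filter_subset _ _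
    · exact Finset.filter_subset _ _
  have h7 := Finset.card_le_card hsub
  rw [Finset.card_union_of_disjoint hd2, Finset.card_union_of_disjoint hd1, Int.card_Ico] at h7
  have h8 := Finset.pred_card_le_card_erase (s := A') (a := B.min' hBne)
  have := C.le_m
  omega

/-- The first neighbour of `u i` among `w i, w (i + 1), …`, when `u i ∉ J`. -/
lemma exists_first {i : ℤ} (hu : C.u i ∉ C.J) : ∃ L, i ≤ L ∧ L < i + C.m ∧
    Γ.Adj (C.u i) (C.w L) ∧ (∀ l, i ≤ l → l < L → ¬ Γ.Adj (C.u i) (C.w l)) ∧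
    L - i + 1 < k ∧ (C.m + 1 : ℤ) ≤ k + (L - i) ∧
    ∀ l, L ≤ l → l < i + C.m → ¬ Γ.Adj (C.c (C.q i)) (C.w l) := by
  classical
  have huh : ¬ Γ.Adj (C.u i) C.h := fun h => C.not_adj_h_u i h.symm
  have hA := C.le_card_nbrs' hu (C.u_ne_omega i) huh i
  have hB := C.le_card_nbrs (C.q_notMem_J i) (C.q_ne_omega i) i
  set A := C.nbrs (C.u i) i
  set B := C.nbrs (C.c (C.q i)) i
  have hne : A.Nonempty := Finset.card_pos.1 (by have := C.k_le; omega)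
  have hmem := A.min'_mem hne
  have hmin : ∀ l ∈ A, A.min' hne ≤ l := fun l hl => A.min'_le l hl
  set L := A.min' hne
  rw [mem_nbrs] at hmem
  have hcut := C.p_lt_q (show i - 1 < i by omega)
  have hlast : ∀ l, L ≤ l → l < i + C.m → ¬ Γ.Adj (C.c (C.q i)) (C.w l) := by
    intro l hl hl' hadj
    have := C.lt_of_adj_cut (by omega) (C.q_le i) hmem.1.1 hmem.1.2 (by omega) hl' hmem.2 hadj
    omega
  have hfirst : ∀ l, i ≤ l → l < L → ¬ Γ.Adj (C.u i) (C.w l) := by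
    intro l h1 h2 hadj
    have := hmin l (C.mem_nbrs.2 ⟨⟨h1, by omega⟩, hadj⟩)
    omega
  refine ⟨L, hmem.1.1, hmem.1.2, hmem.2, hfirst, ?_, ?_, hlast⟩
  · have h := C.card_w_add_one_lt hu (C.u_ne_omega i) huh (i := i) (T := Finset.Ico i L)
      (fun t ht => by rw [Finset.mem_Ico] at ht; omega)
      (fun t ht => by rw [Finset.mem_Ico] at ht; exact hfirst t ht.1 ht.2)
    rw [Int.card_Ico] at h
    omega
  · have h : B ⊆ Finset.Ico i L := by
      intro l hl
      rw [mem_nbrs] at hl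
      rw [Finset.mem_Ico]
      refine ⟨hl.1.1, ?_⟩
      by_contra h
      exact hlast l (not_lt.1 h) hl.1.2 hl.2
    have := Finset.card_le_card h
    rw [Int.card_Ico] at this
    omega

/-- If `w t` had u-neighbours, the reversed cut at `p t` would order them after those of `c (p t)`.
The edge from `u t` to its first w-neighbour `w j` confines both sets, apart from the index of `u t`
itself, to j - t ≤ k - 2 indices, too few for them. -/
lemma w_mem_rev_J (hm : k < C.m) {t : ℤ} (ht : C.q t = C.p t) (hu : C.u t ∉ C.J) :
    C.w t ∈ C.rev.J := by
  classical
  obtain ⟨j, h1, h2, h3, -, h4, -, -⟩ := C.exists_first hu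
  by_contra hw
  have hru : C.rev.u (-t) = C.w t := by rw [rev_u, neg_neg]
  have hrq : C.rev.c (C.rev.q (-t)) = C.c (C.p t) := by
    change C.c (- - C.p (- -t)) = _
    rw [neg_neg, neg_neg]
  have hrm : C.rev.m = C.m := rfl
  have hA := C.rev.le_card_nbrs' hw (C.w_ne_omega t) (fun h => C.not_adj_h_w t h.symm) (-t)
  have hB := C.rev.le_card_nbrs (C.rev.q_notMem_J (-t)) (C.rev.q_ne_omega (-t)) (-t)
  rw [hrq] at hB
  rw [hrm] at hA hB
  set A := C.rev.nbrs (C.w t) (-t)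
  set B := C.rev.nbrs (C.c (C.p t)) (-t)
  have hBA : ∀ l ∈ B, ∀ i ∈ A, l < i := by
    intro l hl i hi
    rw [mem_nbrs] at hl hi
    have hcut := C.rev.p_lt_q (show -t - 1 < -t by omega)
    refine C.rev.lt_of_adj_cut (s := C.rev.q (-t)) (i := -t) (by omega) (C.rev.q_le _)
      hi.1.1 hi.1.2 hl.1.1 hl.1.2 ?_ ?_
    · have := hi.2
      rwa [← hru] at this
    · rw [hrq]; exact hl.2
  have hlow : ∀ e ∈ B.erase (-t), C.m - j ≤ e := by
    intro e he
    -- Index `e` of the reversed structure is `-e` here, and `-e + m` lies in the window starting at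
    -- `t`.
    rw [Finset.mem_erase, mem_nbrs, rev_w, hrm] at he
    obtain ⟨he1, ⟨he2, he3⟩, he4⟩ := he
    by_contra hlt
    rw [← C.u_add] at he4
    have h5 : -e + C.m < t + C.m := by omega
    have h6 := C.q_strictMono h5
    rw [C.q_add t] at h6
    rw [← ht] at he4
    exact C.not_adj_succ_pred C.off ((C.q_le t).trans (C.p_strictMono.monotone h1))
      (C.p_lt_q (show j < -e + C.m by omega)) h6 (C.adj_p j) (C.adj_q _) h3 he4
  have hcard := Finset.pred_card_le_card_erase (s := B) (a := -t)
  obtain ⟨e, he⟩ : (B.erase (-t)).Nonempty := Finset.card_pos.1 (by omega)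
  have hd : Disjoint (B.erase (-t)) A := by
    rw [Finset.disjoint_left]
    intro l hl hl'
    exact (hBA l (Finset.mem_of_mem_erase hl) l hl').false
  have hsub : B.erase (-t) ∪ A ⊆ Finset.Ico (C.m - j) (C.m - t) := by
    intro l hl
    rw [Finset.mem_Ico]
    rcases Finset.mem_union.1 hl with hl | hl
    · have h5 := hlow l hl
      have h6 := (C.rev.mem_nbrs.1 (Finset.mem_of_mem_erase hl)).1.2
      rw [hrm] at h6
      omega
    · have h5 := hlow e he
      have h7 := hBA e (Finset.mem_of_mem_erase he) l hl
      have h6 := (C.rev.mem_nbrs.1 hl).1.2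
      rw [hrm] at h6
      omega
  have h8 := Finset.card_le_card hsub
  rw [Finset.card_union_of_disjoint hd, Int.card_Ico] at h8
  have := C.le_m
  omega

/-- Each index after `L` in the window supplies a non-neighbour of `u i`: either `u t` in J, or `w
t` by `w_mem_rev_J`. Together with `h` and the w's before `L`, the two kinds form two subsets of J,
each of size below k; adding the two bounds gives 2m + 4 ≤ 3k. -/
lemma not_lt_m : ¬ k < C.m := by
  classical
  intro hm
  -- Only the junction at multiples of m can escape `w_mem_rev_J`, so it is chosen as `i` whenever
  -- its u lies outside J.
  obtain ⟨i, hi, hall⟩ : ∃ i, C.u i ∉ C.J ∧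
      ∀ t, i < t → t < i + C.m → C.u t ∈ C.J ∨ C.w t ∈ C.rev.J := by
    by_cases h0 : C.u 0 ∈ C.J
    · obtain ⟨i, hi⟩ := C.exists_u_notMem
      refine ⟨i, hi, fun t _ _ => ?_⟩
      by_cases ht : (C.m : ℤ) ∣ t
      · obtain ⟨a, rfl⟩ := ht
        left
        have := C.u_add_mul 0 a
        rw [zero_add, mul_comm] at this
        rwa [this]
      · by_cases hu : C.u t ∈ C.J
        · exact Or.inl hu
        · exact Or.inr (C.w_mem_rev_J hm (C.q_eq t ht) hu)
    · refine ⟨0, h0, fun t h1 h2 => ?_⟩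
      by_cases hu : C.u t ∈ C.J
      · exact Or.inl hu
      · refine Or.inr (C.w_mem_rev_J hm (C.q_eq t fun hd => ?_) hu)
        have := Int.le_of_dvd h1 hd
        omega
  obtain ⟨L, h1, h2, h3, h4, h5, h6, -⟩ := C.exists_first hi
  have huh : ¬ Γ.Adj (C.u i) C.h := fun h => C.not_adj_h_u i h.symm
  set Tu : Finset ℤ := {t ∈ Finset.Ioo L (i + C.m) | C.u t ∈ C.J} with hTu
  set Tw : Finset ℤ := {t ∈ Finset.Ioo L (i + C.m) | ¬ C.u t ∈ C.J} with hTw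
  have hTT : (Tu.card + Tw.card : ℤ) = i + C.m - L - 1 := by
    have : Tu.card + Tw.card = _ := Finset.card_filter_add_card_filter_not _
    rw [Int.card_Ioo] at this
    omega
  have hmw : ∀ t ∈ Tw, (L < t ∧ t < i + C.m) ∧ C.u t ∉ C.J := by
    intro t ht; simpa [hTw] using ht
  have hmu : ∀ t ∈ Tu, (L < t ∧ t < i + C.m) ∧ C.u t ∈ C.J := by
    intro t ht; simpa [hTu] using ht
  have hw : (L - i) + Tw.card + 1 < k := by
    have hd : Disjoint (Finset.Ico i L) Tw := by
      rw [Finset.disjoint_left]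
      intro t ht ht'
      rw [Finset.mem_Ico] at ht
      have := (hmw t ht').1.1
      omega
    have := C.card_w_add_one_lt hi (C.u_ne_omega i) huh (i := i) (T := Finset.Ico i L ∪ Tw) ?_ ?_
    · rw [Finset.card_union_of_disjoint hd, Int.card_Ico] at this
      omega
    · intro t ht
      rcases Finset.mem_union.1 ht with ht | ht
      · rw [Finset.mem_Ico] at ht; omega
      · have := hmw t ht; omega
    · intro t ht
      rcases Finset.mem_union.1 ht with ht | ht
      · rw [Finset.mem_Ico] at ht; exact h4 t ht.1 ht.2
      · have h7 := hmw t ht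
        have h8 := (hall t (by omega) h7.1.2).resolve_left h7.2
        have h9 := (C.rev.mem_J.1 h8).2.1 (-i)
        rw [rev_w, neg_neg] at h9
        exact fun h => h9 h.symm
  have hu : (L - i) + Tu.card + 1 < k := by
    have hc : (insert C.h ((Finset.Ico i L).image C.w ∪ Tu.image C.u)).card
        = (L - i).toNat + Tu.card + 1 := by
      rw [Finset.card_insert_of_notMem, Finset.card_union_of_disjoint,
        Finset.card_image_of_injOn, Finset.card_image_of_injOn, Int.card_Ico]
      · refine (C.u_injOn i).mono fun t ht => ?_
        have := hmu t ht
        simp only [Set.mem_Ico]; omega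
      · refine (C.w_injOn i).mono fun t ht => ?_
        simp only [Finset.coe_Ico, Set.mem_Ico] at ht ⊢; omega
      · rw [Finset.disjoint_left]
        intro x hx hx'
        obtain ⟨s, hs, rfl⟩ := Finset.mem_image.1 hx
        obtain ⟨t, ht, hst⟩ := Finset.mem_image.1 hx'
        rw [Finset.mem_Ico] at hs
        have := hmu t ht
        exact C.w_ne_u (by omega) (by omega) hst.symm
      · simp only [Finset.mem_union, Finset.mem_image, not_or, not_exists, not_and]
        exact ⟨fun t _ => C.w_ne_h t, fun t _ => C.u_ne_h t⟩
    have := C.card_lt_of_notMem hi (C.u_ne_omega i)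
      (S := insert C.h ((Finset.Ico i L).image C.w ∪ Tu.image C.u)) ?_ ?_
    · rw [hc] at this
      omega
    · intro x hx
      simp only [Finset.mem_insert, Finset.mem_union, Finset.mem_image] at hx
      rcases hx with rfl | ⟨t, -, rfl⟩ | ⟨t, ht, rfl⟩
      · exact C.h_mem_J
      · exact C.w_mem_J t
      · exact (hmu t ht).2
    · intro x hx
      simp only [Finset.mem_insert, Finset.mem_union, Finset.mem_image] at hx
      rcases hx with rfl | ⟨t, ht, rfl⟩ | ⟨t, ht, rfl⟩
      · exact huh
      · rw [Finset.mem_Ico] at ht; exact h4 t ht.1 ht.2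
      · exact C.not_adj_u_u i t
  have := C.le_m
  omega

lemma not_adj_between {i t : ℤ} (h1 : C.p (i - 1) < t) (h2 : t < C.q i) :
    ¬ Γ.Adj C.h (C.c t) := by
  intro h
  obtain ⟨j, rfl | rfl⟩ := C.of_adj t h
  · have h3 := C.p_strictMono.lt_iff_lt.1 h1
    have h4 := C.p_strictMono.monotone (show i ≤ j by omega)
    have := C.q_le i
    omega
  · have h3 := C.q_strictMono.lt_iff_lt.1 h2
    have h4 := C.p_strictMono.monotone (show j ≤ i - 1 by omega)
    have := C.q_le j
    omega

/-! ### The extremal case k = m = 3. -/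

section Three

lemma c_eq_of_succ {i j : ℤ} (h : C.c (i + 1) = C.c (j + 1)) : C.c i = C.c j := by
  obtain ⟨a, ha⟩ := C.inj _ _ h
  rw [← C.periodic_mul j a]; congr 1; linarith

variable (hk : k = 3) (hm : C.m = 3)
include hk hm

/-- The bounds of `exists_first` leave only `L = i + 1`, and `u i` already has the two
non-neighbours `h` and `w i` in J, the most it can have. -/
lemma three_adj {i : ℤ} (hu : C.u i ∉ C.J) : ¬ Γ.Adj (C.u i) (C.w i) ∧
    Γ.Adj (C.u i) (C.w (i + 1)) ∧ Γ.Adj (C.u i) (C.w (i + 2)) ∧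
    ¬ Γ.Adj (C.c (C.q i)) (C.w (i + 1)) ∧ ¬ Γ.Adj (C.c (C.q i)) (C.w (i + 2)) := by
  obtain ⟨L, h1, h2, h3, h4, h5, h6, h7⟩ := C.exists_first hu
  obtain rfl : L = i + 1 := by omega
  refine ⟨h4 i le_rfl (by omega), h3, ?_, h7 _ le_rfl (by omega), h7 _ (by omega) (by omega)⟩
  by_contra hn
  have := C.card_w_add_one_lt hu (C.u_ne_omega i) (fun h => C.not_adj_h_u i h.symm) (i := i)
    (T := {i, i + 2}) (by simp; omega) (by simpa using ⟨h4 i le_rfl (by omega), hn⟩)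
  rw [Finset.card_pair (by omega)] at this
  omega

lemma three_adj_of_mem {i : ℤ} (hu : C.u i ∉ C.J) {x : X} (hx : x ∈ C.J) (hxh : x ≠ C.h)
    (hxw : x ≠ C.w i) : Γ.Adj (C.u i) x := by
  classical
  by_contra hn
  have := C.card_lt_of_notMem hu (C.u_ne_omega i) (S := {C.h, C.w i, x}) ?_ ?_
  · rw [Finset.card_eq_three.2 ⟨_, _, _, (C.w_ne_h i).symm, hxh.symm, hxw.symm, rfl⟩] at this
    omega
  · intro y hy
    simp only [Finset.mem_insert, Finset.mem_singleton] at hy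
    rcases hy with rfl | rfl | rfl
    exacts [C.h_mem_J, C.w_mem_J i, hx]
  · intro y hy
    simp only [Finset.mem_insert, Finset.mem_singleton] at hy
    rcases hy with rfl | rfl | rfl
    exacts [fun h => C.not_adj_h_u i h.symm, (C.three_adj hk hm hu).1, hn]

/-- If `u i` is outside J then so is `u (i + 2)`, since otherwise the two would be adjacent by
`three_adj_of_mem`. Steps of 2 reach every residue modulo 3. -/
lemma three_u_notMem (i : ℤ) : C.u i ∉ C.J := by
  have step : ∀ i, C.u i ∉ C.J → C.u (i + 2) ∉ C.J := by
    intro i hu hx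
    exact C.not_adj_u_u i (i + 2) (C.three_adj_of_mem hk hm hu hx (C.u_ne_h _)
      (C.w_ne_u (by omega) (by omega)).symm)
  obtain ⟨j, hj⟩ := C.exists_u_notMem
  obtain ⟨a, h1, h2⟩ := C.exists_add_mul j i
  rw [← C.u_add_mul i a]
  rw [hm] at h1 h2 ⊢
  push_cast at *
  obtain h | h | h : i + a * 3 = j ∨ i + a * 3 = j + 1 ∨ i + a * 3 = j + 2 := by omega
  · rwa [h]
  · have h3 := step _ (step _ hj)
    rwa [h, ← C.u_add, hm, show j + 1 + ((3 : ℕ) : ℤ) = j + 2 + 2 by push_cast; ring]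
  · rw [h]; exact step _ hj

/-- Any further member of J is adjacent to every u, hence lies on the cycle. Crossing rules using
these edges then give a cycle neighbour of it, other than ω, three non-neighbours in J. -/
lemma three_mem_J {x : X} (hx : x ∈ C.J) (hxh : x ≠ C.h) : ∃ j, x = C.w j := by
  by_contra! hxw
  have hxu : ∀ i, Γ.Adj (C.u i) x := fun i =>
    C.three_adj_of_mem hk hm (C.three_u_notMem hk hm i) hx hxh (hxw i)
  obtain ⟨s, rfl⟩ : ∃ s, C.c s = x := by
    by_contra! hoff
    have h := C.rev.not_adj_off_w (z := x) (fun i => hoff (-i)) 0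
    rw [rev_w] at h
    exact h (hxu _).symm
  obtain ⟨i, h1, h2⟩ := C.exists_p s
  have h1' : C.p (i - 1) + 1 < s := by
    rcases (show C.p (i - 1) + 1 ≤ s by omega).lt_or_eq with h | h
    · exact h
    · exact absurd (by rw [w, h]) (hxw (i - 1))
  have hper : C.p (i + 2) = C.p (i - 1) + C.n := by
    rw [← C.p_add, hm]; congr 1; push_cast; ring
  have hq2 := C.q_le (i + 2)
  have hq3 : C.q (i + 3) = C.q i + C.n := by
    rw [← C.q_add, hm]; rfl
  have hq12 := C.q_strictMono (show i + 1 < i + 2 by omega)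
  have hmono := C.p_strictMono.monotone
  -- Non-neighbours of ω are not controlled, so if ω precedes `x` the successor of `x` is used
  -- instead.
  by_cases hω : C.c (s - 1) = ω
  · have hq : C.q i < s - 1 := by
      by_contra hlt
      exact C.ne_omega (i - 1) (s - 1) (by omega) (by rw [sub_add_cancel]; omega) hω
    have h2' : s < C.p i := by
      rcases h2.lt_or_eq with h | h
      · exact h
      · exact absurd (h ▸ C.adj_p i) (C.J_indep _ C.h_mem_J _ hx)
    have hg : C.c (s + 1) ∉ C.J := fun h => C.J_indep _ hx _ h (C.adj s)
    have hgω : C.c (s + 1) ≠ ω := by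
      intro h
      have := C.three_le
      have := C.eq_of_c_eq (h.trans hω.symm) (by omega) (by omega)
      omega
    have hmiss : ∀ j, i ≤ j → C.q (j + 1) < s + 1 + C.n →
        ¬ Γ.Adj (C.c (s + 1)) (C.w j) := by
      intro j hij hj hadj
      refine C.not_adj_pred_succ C.off (s := s + 1) (i := C.p j) (j := C.q (j + 1)) ?_
        (C.p_lt_q (by omega)) hj (C.adj_p j) (C.adj_q _) hadj ?_
      · have := hmono hij; omega
      · rw [add_sub_cancel_right]; exact (hxu _).symm
    have := C.card_w_lt hg hgω (i := i) (T := Finset.Ico i (i + 3))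
      (fun t ht => by rw [Finset.mem_Ico] at ht; omega) ?_
    · rw [Int.card_Ico] at this; omega
    · intro t ht
      rw [Finset.mem_Ico] at ht
      have h3 := C.q_strictMono.monotone (show t + 1 ≤ i + 3 by omega)
      exact hmiss t ht.1 (by omega)
  · have hf : C.c (s - 1) ∉ C.J := fun h => by
      have := C.adj (s - 1)
      rw [sub_add_cancel] at this
      exact C.J_indep _ h _ hx this
    have hmiss : ∀ j, i ≤ j → C.q (j + 1) < s + C.n → ¬ Γ.Adj (C.c (s - 1)) (C.w j) := by
      intro j hij hj hadj
      exact C.not_adj_succ_pred C.off (h2.trans (hmono hij)) (C.p_lt_q (by omega)) hj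
        (C.adj_p j) (C.adj_q _) hadj (hxu _).symm
    by_cases hq : C.q i < s
    · have := C.card_w_lt hf hω (i := i) (T := Finset.Ico i (i + 3))
        (fun t ht => by rw [Finset.mem_Ico] at ht; omega) ?_
      · rw [Int.card_Ico] at this; omega
      · intro t ht
        rw [Finset.mem_Ico] at ht
        have h3 := C.q_strictMono.monotone (show t + 1 ≤ i + 3 by omega)
        exact hmiss t ht.1 (by omega)
    -- Here the third w is out of reach of the rule, and `h` serves as the third non-neighbour.
    · have := C.card_w_add_one_lt hf hω
        (fun h => C.not_adj_between (i := i) (by omega) (by omega) h.symm) (i := i)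
        (T := Finset.Ico i (i + 2)) (fun t ht => by rw [Finset.mem_Ico] at ht; omega) ?_
      · rw [Int.card_Ico] at this; omega
      · intro t ht
        rw [Finset.mem_Ico] at ht
        have h3 := C.q_strictMono.monotone (show t + 1 ≤ i + 2 by omega)
        exact hmiss t ht.1 (by omega)

/-- Otherwise this vertex would lie in J and be some `w j`, putting a `p j` strictly between `p (i -
1)` and `p i`. With its mirror image, this shows that the long junction contains only ω between its
ends. -/
lemma three_succ_eq_omega {i : ℤ} (hi : C.q i < C.p i) : C.c (C.q i + 1) = ω := by
  by_contra hω
  obtain ⟨j, hj⟩ := C.three_mem_J hk hm (C.succ_mem_J (C.adj_q i) hω) (C.off _)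
  obtain ⟨a, ha⟩ := C.inj _ _ hj
  have h1 : C.p (j + a * C.m) = C.q i := by rw [C.p_add_mul]; linarith
  have h2 := C.p_lt_q (show i - 1 < i by omega)
  have h3 := C.p_strictMono.lt_iff_lt.1 (show C.p (i - 1) < C.p (j + a * C.m) by omega)
  have h4 := C.p_strictMono.lt_iff_lt.1 (show C.p (j + a * C.m) < C.p i by omega)
  omega

/-- Apart from ω, the neighbours of `w 1` are among `c (p 1)`, `u 2` and `u 3`, while the degree
condition asks for at least four. -/
lemma three_false : False := by
  classical
  have hu := fun i => C.three_adj hk hm (C.three_u_notMem hk hm i)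
  have hw1 : C.w 4 = C.w 1 := by
    have := C.w_add 1
    rw [hm] at this
    exact this
  have hv2 : ¬ Γ.Adj (C.c (C.q 2)) (C.w 1) := by
    have := (hu 2).2.2.2.2
    rwa [show (2 : ℤ) + 2 = 4 by norm_num, hw1] at this
  have hv3 : ¬ Γ.Adj (C.c (C.q 3)) (C.w 1) := by
    have := (hu 3).2.2.2.1
    rwa [show (3 : ℤ) + 1 = 4 by norm_num, hw1] at this
  -- This is the chord rule cut at `q (-1)`, using the edge from `u (-1)` to `w 0`.
  have hp0 : ¬ Γ.Adj (C.c (C.p 0)) (C.w 1) := by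
    intro hadj
    have h1 := (hu (-1)).2.1
    rw [show (-1 : ℤ) + 1 = 0 by norm_num] at h1
    have h2 := C.q_add (-1)
    rw [hm, show (-1 : ℤ) + (3 : ℕ) = 2 by norm_num] at h2
    have h3 := C.p_lt_q (show (1 : ℤ) < 2 by norm_num)
    exact C.not_adj_chord C.off (s := C.q (-1)) (i := C.p 0) (j := C.p 1)
      ((C.q_le _).trans (C.p_strictMono.monotone (by norm_num)))
      (C.p_strictMono (by norm_num)) (by omega) (C.adj_q _) (C.adj_p _) h1 hadj
  have hq : ∀ i, ¬ (3 : ℤ) ∣ i → C.q i = C.p i := by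
    have := C.q_eq
    rwa [hm] at this
  have hcp : ∀ i a : ℤ, C.c (C.p (i + a * 3)) = C.c (C.p i) := by
    intro i a
    have := C.p_add_mul i a
    rw [hm] at this
    push_cast at this
    rw [this, C.periodic_mul]
  have hcq : ∀ i a : ℤ, C.c (C.q (i + a * 3)) = C.c (C.q i) := by
    intro i a
    have := C.q_add_mul i a
    rw [hm] at this
    push_cast at this
    rw [this, C.periodic_mul]
  have hcu : ∀ i a : ℤ, C.u (i + a * 3) = C.u i := by
    intro i a
    have := C.u_add_mul i a
    rw [hm] at this
    exact this
  have hred : ∀ i j : ℤ, ∃ a : ℤ, i + a * 3 = j ∨ i + a * 3 = j + 1 ∨ i + a * 3 = j + 2 := by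
    intro i j
    obtain ⟨a, h1, h2⟩ := C.exists_add_mul j i
    rw [hm] at h1 h2
    push_cast at h1 h2
    exact ⟨a, by omega⟩
  have hdeg := C.le_degree (C.w 1) (C.w_ne_omega 1) {C.c (C.p 1), C.u 2, C.u 3} ?_
  · have := Finset.card_le_three (a := C.c (C.p 1)) (b := C.u 2) (c := C.u 3)
    omega
  intro f hfω hadj
  simp only [Finset.mem_insert, Finset.mem_singleton]
  obtain ⟨s, rfl⟩ : ∃ s, C.c s = f := by
    by_contra! hoff
    exact C.not_adj_off_w hoff 1 hadj.symm
  have hfJ : C.c s ∉ C.J := fun h => C.J_indep _ (C.w_mem_J 1) _ h hadj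
  obtain ⟨i, h1, h2⟩ := C.exists_p s
  rcases h2.eq_or_lt with rfl | h2
  · obtain ⟨a, ha⟩ := hred i 0
    rw [← hcp i a] at hadj ⊢
    rcases ha with ha | ha | ha <;> rw [ha] at hadj ⊢
    · exact absurd hadj.symm hp0
    · exact Or.inl rfl
    · rw [show (0 : ℤ) + 2 = 2 by norm_num, ← hq 2 (by norm_num)] at hadj
      exact absurd hadj.symm hv2
  rcases lt_trichotomy s (C.q i) with h3 | rfl | h3
  · rcases (show s + 1 ≤ C.q i by omega).eq_or_lt with h4 | h4
    · have hsu : C.c s = C.u i := by rw [u, ← h4, add_sub_cancel_right]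
      obtain ⟨a, ha⟩ := hred i 1
      rw [hsu, ← hcu i a] at hadj ⊢
      rcases ha with ha | ha | ha <;> rw [ha] at hadj ⊢
      · exact absurd hadj.symm (hu 1).1
      · exact Or.inr (Or.inl rfl)
      · exact Or.inr (Or.inr rfl)
    -- In the interior of an arc, `c s` and `c (s + 1)` both miss `h` and lie outside J. Each has at
    -- least two neighbours among three w's, and the cut makes these sets disjoint.
    · exfalso
      have hfh : ¬ Γ.Adj C.h (C.c s) := C.not_adj_between h1 h3
      have hgh : ¬ Γ.Adj C.h (C.c (s + 1)) := C.not_adj_between (by omega) h4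
      have hgω : C.c (s + 1) ≠ ω :=
        C.ne_omega (i - 1) _ (by omega) (by rw [sub_add_cancel]; omega)
      have hgJ : C.c (s + 1) ∉ C.J := by
        intro hgJ
        obtain ⟨j, hj⟩ := C.three_mem_J hk hm hgJ (C.off _)
        exact hfh (C.c_eq_of_succ hj ▸ C.adj_p j)
      have hA := C.le_card_nbrs' hfJ hfω (fun h => hfh h.symm) i
      have hB := C.le_card_nbrs' hgJ hgω (fun h => hgh h.symm) i
      have hd : Disjoint (C.nbrs (C.c s) i) (C.nbrs (C.c (s + 1)) i) := by
        rw [Finset.disjoint_left]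
        intro j hj hj'
        rw [mem_nbrs] at hj hj'
        refine (C.lt_of_adj_cut (s := s + 1) (by omega) (by omega) hj.1.1 hj.1.2 hj.1.1 hj.1.2
          ?_ hj'.2).false
        rw [add_sub_cancel_right]; exact hj.2
      have hsub : C.nbrs (C.c s) i ∪ C.nbrs (C.c (s + 1)) i ⊆ Finset.Ico i (i + C.m) :=
        Finset.union_subset (Finset.filter_subset _ _) (Finset.filter_subset _ _)
      have := Finset.card_le_card hsub
      rw [Finset.card_union_of_disjoint hd, Int.card_Ico] at this
      omega
  · obtain ⟨a, ha⟩ := hred i 1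
    rw [← hcq i a] at hadj ⊢
    rcases ha with ha | ha | ha <;> rw [ha] at hadj ⊢
    · rw [hq 1 (by norm_num)]; exact Or.inl rfl
    · exact absurd hadj.symm hv2
    · exact absurd hadj.symm hv3
  · exfalso
    have h4 := C.three_succ_eq_omega hk hm (h3.trans h2)
    have h5 : C.c (C.p i - 1) = ω := by
      have h6 : C.rev.q (-i) < C.rev.p (-i) := by
        change - C.p (- -i) < - C.q (- -i)
        rw [neg_neg]; omega
      have h7 := C.rev.three_succ_eq_omega hk hm h6
      change C.c (-(- C.p (- -i) + 1)) = ω at h7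
      rwa [neg_neg, show -(-C.p i + 1) = C.p i - 1 by ring] at h7
    have h6 : C.p i < C.p (i - 1) + C.n := by
      rw [← C.p_add, hm]
      exact C.p_strictMono (by push_cast; omega)
    have h7 := C.p_lt_q (show i - 1 < i by omega)
    have h8 := C.eq_of_c_eq (h4.trans h5.symm) (by omega) (by omega)
    obtain rfl : s = C.q i + 1 := by omega
    exact hfω h4

end Three

/-- Such a configuration does not exist. -/
theorem false {X : Type*} [Fintype X] {Γ : SimpleGraph X} {ω : X} {k : ℕ}
    (C : Junctions Γ ω k) : False := by
  have h1 := C.not_lt_m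
  have h2 := C.k_le
  have h3 := C.le_m
  have h4 := C.two_le
  obtain hk | hk : k = 2 ∨ k = 3 := by omega
  · obtain ⟨i, hi⟩ := C.exists_u_notMem
    obtain ⟨L, -, -, -, -, h5, h6, -⟩ := C.exists_first hi
    omega
  · exact C.three_false hk (by omega)

end Junctions

end SimpleGraph

/-! ### From a longest cycle missing a vertex to a system of junctions. -/

namespace SimpleGraph

variable {X : Type*}

namespace LongestCycle

variable {Γ : SimpleGraph X} {ω : X} (C : LongestCycle Γ ω)

/-- The same cycle with the origin moved to position `r`. -/
def shift (r : ℤ) : LongestCycle Γ ω where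
  n := C.n
  c i := C.c (i + r)
  periodic i := by rw [← C.periodic (i + r)]; congr 1; ring
  inj i j h := by
    have := C.inj _ _ h
    rwa [show i + r - (j + r) = i - j by ring] at this
  adj i := by
    have := C.adj (i + r)
    rwa [show i + r + 1 = i + 1 + r by ring] at this
  three_le := C.three_le
  exists_eq := by
    obtain ⟨i, hi⟩ := C.exists_eq
    exact ⟨i - r, by rwa [sub_add_cancel]⟩
  length_le := C.length_le

/-- Consecutive neighbours of a vertex set `Z` whose members are joined by paths off the cycle. -/
def Attached (Z : Set X) : Prop :=
  (∀ z ∈ Z, ∀ i, C.c i ≠ z) ∧ ∀ a ∈ Z, ∀ b ∈ Z,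
    ∃ l, PathList Γ l a b ∧ l.Nodup ∧ ∀ z ∈ l, ∀ i, C.c i ≠ z

variable {C}

lemma attached_singleton {h : X} (hh : ∀ i, C.c i ≠ h) : C.Attached {h} := by
  refine ⟨by simpa using hh, ?_⟩
  rintro _ rfl _ rfl
  exact ⟨_, PathList.singleton Γ _, by simp, by simpa using hh⟩

lemma attached_reachable {h : X} (hh : ∀ i, C.c i ≠ h) :
    C.Attached {v | ∃ hv : v ∈ {z | ∀ i, C.c i ≠ z},
      (Γ.induce {z | ∀ i, C.c i ≠ z}).Reachable ⟨h, hh⟩ ⟨v, hv⟩} := by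
  refine ⟨fun z hz => hz.1, ?_⟩
  rintro a ⟨ha, hra⟩ b ⟨hb, hrb⟩
  obtain ⟨p, hp⟩ := (hra.symm.trans hrb).exists_isPath
  refine ⟨p.support.map Subtype.val, ⟨?_, ?_, ?_⟩, ?_, ?_⟩
  · rw [List.isChain_map]
    exact p.isChain_adj_support.imp fun _ _ h => h
  · rw [List.head?_map, List.head?_eq_some_head p.support_ne_nil]; simp
  · rw [List.getLast?_map, List.getLast?_eq_some_getLast p.support_ne_nil]; simp
  · exact hp.support_nodup.map Subtype.val_injective
  · intro z hz
    obtain ⟨z', -, rfl⟩ := List.mem_map.1 hz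
    exact z'.2

lemma Attached.not_adj_succ {Z : Set X} (hZ : C.Attached Z) {a b : X} (ha : a ∈ Z) (hb : b ∈ Z)
    {t : ℤ} (hat : Γ.Adj a (C.c t)) : ¬ Γ.Adj b (C.c (t + 1)) := by
  obtain ⟨l, h1, h2, h3⟩ := hZ.2 a ha b hb
  exact C.not_adj_of_adj h1 h2 h3 hat

lemma Attached.not_adj_succ_succ {Z : Set X} (hZ : C.Attached Z) {a b : X} (ha : a ∈ Z)
    (hb : b ∈ Z) {s t : ℤ} (has : Γ.Adj a (C.c s)) (hbt : Γ.Adj b (C.c t)) :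
    ¬ Γ.Adj (C.c (s + 1)) (C.c (t + 1)) := by
  obtain ⟨r, h1, h2, h3, h4⟩ := C.exists_mem_Ico t s
  have h5 : C.c (t + 1) = C.c (r + 1) := by
    obtain ⟨a, ha⟩ := h4
    rw [← C.periodic_mul (r + 1) a]; congr 1; linarith
  rw [h5]
  rcases h1.eq_or_lt with rfl | h1
  · exact Γ.irrefl
  · obtain ⟨l, h6, h7, h8⟩ := hZ.2 a ha b hb
    exact C.not_adj_succ_succ h6 h7 h8 h1 h2 has (h3 ▸ hbt)

variable {k : ℕ}
  (hconn : ∀ S : Finset X, ω ∉ S → S.card ≤ k → ∀ Z : Set X,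
    (∀ a ∈ Z, ∀ b, b ≠ ω → b ∉ S → Γ.Adj a b → b ∈ Z) →
    ∀ a ∈ Z, ∀ b, a ≠ ω → b ≠ ω → a ∉ S → b ∉ S → b ∈ Z)
include hconn

/-- With at most k attachments, S would separate Z from any remaining cycle vertex other than ω. If
none remains, the two positions after ω are both attached, contradicting `not_adj_succ`. -/
lemma Attached.lt_card {Z : Set X} (hZ : C.Attached Z) {h : X} (hh : h ∈ Z)
    (hcl : ∀ a ∈ Z, ∀ b, (∀ i, C.c i ≠ b) → Γ.Adj a b → b ∈ Z) (S : Finset X) (hω : ω ∉ S)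
    (hS : ∀ v ∈ S, ∃ i, C.c i = v ∧ ∃ z ∈ Z, Γ.Adj z v)
    (hS' : ∀ i, C.c i ≠ ω → (∃ z ∈ Z, Γ.Adj z (C.c i)) → C.c i ∈ S) : k < S.card := by
  by_contra hlt
  have hcl' : ∀ a ∈ Z, ∀ b, b ≠ ω → b ∉ S → Γ.Adj a b → b ∈ Z := by
    intro a ha b hb hbS hab
    by_contra hbZ
    by_cases hbc : ∃ i, C.c i = b
    · obtain ⟨i, rfl⟩ := hbc
      exact hbS (hS' i hb ⟨a, ha, hab⟩)
    · push Not at hbc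
      exact hbZ (hcl a ha b hbc hab)
  have hhS : h ∉ S := fun hhS => by
    obtain ⟨i, hi, -⟩ := hS h hhS
    exact hZ.1 h hh i hi
  obtain ⟨i, hi⟩ := C.exists_eq
  have hhω : h ≠ ω := by rintro rfl; exact hZ.1 h hh i hi
  have h3 := C.three_le
  have hne : ∀ j, i < j → j < i + C.n → C.c j ≠ ω := by
    intro j h1 h2 h
    have := C.eq_of_c_eq (h.trans hi.symm) (by omega) (by omega)
    omega
  have hin : ∀ j, i < j → j < i + C.n → C.c j ∈ S := by
    intro j h1 h2
    by_contra hj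
    exact hZ.1 _ (hconn S hω (not_lt.1 hlt) Z hcl' h hh (C.c j) hhω (hne j h1 h2) hhS hj) j rfl
  obtain ⟨_, -, z, hz, hz'⟩ := hS _ (hin (i + 1) (by omega) (by omega))
  obtain ⟨_, -, y, hy, hy'⟩ := hS _ (hin (i + 1 + 1) (by omega) (by omega))
  exact hZ.not_adj_succ hz hy hz' hy'

variable [Fintype X]

/-- The component of the edge off the cycle has more than k attachments. Their successors are
independent and miss both ends of the edge; discarding ω still leaves k of them. -/
lemma not_adj_of_off
    (free : ∀ a b, a ≠ ω → b ≠ ω → Γ.Adj a b → ∀ I : Finset X, ω ∉ I →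
      (∀ x ∈ I, ∀ y ∈ I, ¬ Γ.Adj x y) → (∀ x ∈ I, ¬ Γ.Adj a x ∧ ¬ Γ.Adj b x) → I.card < k)
    {a b : X} (ha : ∀ i, C.c i ≠ a) (hb : ∀ i, C.c i ≠ b) : ¬ Γ.Adj a b := by
  classical
  intro hab
  have hZ := attached_reachable ha
  set Z : Set X := {v | ∃ hv : v ∈ {z | ∀ i, C.c i ≠ z},
    (Γ.induce {z | ∀ i, C.c i ≠ z}).Reachable ⟨a, ha⟩ ⟨v, hv⟩}
  have haZ : a ∈ Z := ⟨ha, Reachable.refl _⟩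
  have hcl : ∀ x ∈ Z, ∀ y, (∀ i, C.c i ≠ y) → Γ.Adj x y → y ∈ Z := by
    rintro x ⟨hx, hrx⟩ y hy hxy
    refine ⟨hy, hrx.trans (Adj.reachable ?_)⟩
    exact hxy
  have hbZ : b ∈ Z := hcl a haZ b hb hab
  let S : Finset X := {v | v ≠ ω ∧ ∃ i, C.c i = v ∧ ∃ z ∈ Z, Γ.Adj z v}
  have hS : ∀ v, v ∈ S ↔ v ≠ ω ∧ ∃ i, C.c i = v ∧ ∃ z ∈ Z, Γ.Adj z v := by simp [S]
  have hcard := hZ.lt_card hconn haZ hcl S (by simp [S]) (fun v hv => ((hS v).1 hv).2)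
    (fun i h1 h2 => (hS _).2 ⟨h1, i, rfl, h2⟩)
  have hpos : ∀ v ∈ S, ∃ i, C.c i = v ∧ ∃ z ∈ Z, Γ.Adj z v := fun v hv => ((hS v).1 hv).2
  choose! f hf using hpos
  have hne : ∀ {v : X}, (∀ i, C.c i ≠ v) → v ≠ ω := by
    rintro v hv rfl
    obtain ⟨i, hi⟩ := C.exists_eq
    exact hv i hi
  have key := free a b (hne ha) (hne hb) hab ((S.image fun v => C.c (f v + 1)).erase ω)
    (Finset.notMem_erase _ _) ?_ ?_
  · have h1 := Finset.pred_card_le_card_erase (s := S.image fun v => C.c (f v + 1)) (a := ω)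
    rw [Finset.card_image_of_injOn] at h1
    · omega
    · intro v hv v' hv' hvv
      obtain ⟨r, hr⟩ := C.inj _ _ hvv
      rw [← (hf v hv).1, ← (hf v' hv').1, ← C.periodic_mul (f v') r]
      congr 1; linarith
  · intro x hx y hy
    obtain ⟨v, hv, rfl⟩ := Finset.mem_image.1 (Finset.mem_of_mem_erase hx)
    obtain ⟨v', hv', rfl⟩ := Finset.mem_image.1 (Finset.mem_of_mem_erase hy)
    obtain ⟨h1, z, hz, h2⟩ := hf v hv
    obtain ⟨h1', z', hz', h2'⟩ := hf v' hv'
    rw [← h1] at h2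
    rw [← h1'] at h2'
    exact hZ.not_adj_succ_succ hz hz' h2 h2'
  · intro x hx
    obtain ⟨v, hv, rfl⟩ := Finset.mem_image.1 (Finset.mem_of_mem_erase hx)
    obtain ⟨h1, z, hz, h2⟩ := hf v hv
    rw [← h1] at h2
    exact ⟨hZ.not_adj_succ hz haZ h2, hZ.not_adj_succ hz hbZ h2⟩

/-- If `Γ` without `ω` is `(k + 1)`-connected and `(K₂ ∪ kK₁)`-free, with small independent sets and
large minimum degree, then a longest cycle through `ω` is spanning. -/
theorem exists_c_eq
    (free : ∀ a b, a ≠ ω → b ≠ ω → Γ.Adj a b → ∀ I : Finset X, ω ∉ I →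
      (∀ x ∈ I, ∀ y ∈ I, ¬ Γ.Adj x y) → (∀ x ∈ I, ¬ Γ.Adj a x ∧ ¬ Γ.Adj b x) → I.card < k)
    (card_lt : ∀ I : Finset X, ω ∉ I → (∀ x ∈ I, ∀ y ∈ I, ¬ Γ.Adj x y) →
      2 * I.card + 1 < Fintype.card X)
    (le_degree : ∀ v, v ≠ ω → ∀ S : Finset X, (∀ f, f ≠ ω → Γ.Adj v f → f ∈ S) →
      3 * k ≤ 2 * S.card + 1)
    (two_le : 2 ≤ k) (hω : ∀ z, Γ.Adj z ω → ∃ i, C.c i = z) (h : X) : ∃ i, C.c i = h := by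
  classical
  obtain ⟨r, hr⟩ := C.exists_eq
  suffices H : ∀ D : LongestCycle Γ ω, D.c 0 = ω → (∀ z, Γ.Adj z ω → ∃ i, D.c i = z) →
      ∃ i, D.c i = h by
    obtain ⟨i, hi⟩ := H (C.shift r) (by simpa [shift] using hr) (by
      intro z hz
      obtain ⟨i, hi⟩ := hω z hz
      exact ⟨i - r, by simpa [shift] using hi⟩)
    exact ⟨i + r, hi⟩
  clear hr hω r
  intro C h0 hω
  by_contra! hh
  have hoff : ∀ z z', (∀ i, C.c i ≠ z) → (∀ i, C.c i ≠ z') → ¬ Γ.Adj z z' :=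
    fun z z' hz hz' => not_adj_of_off hconn free hz hz'
  have hhω : h ≠ ω := fun e => hh 0 (h0.trans e.symm)
  have hn : (0 : ℤ) < C.n := by exact_mod_cast C.n_pos
  let P : Finset ℤ := {t ∈ Finset.Ico 0 (C.n : ℤ) | Γ.Adj h (C.c t)}
  have hP : ∀ t, t ∈ P ↔ (0 ≤ t ∧ t < C.n) ∧ Γ.Adj h (C.c t) := by simp [P]
  have h0P : ∀ t ∈ P, 1 ≤ t := by
    intro t ht
    rw [hP] at ht
    by_contra hlt
    obtain rfl : t = 0 := by omega
    rw [h0] at ht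
    obtain ⟨i, hi⟩ := hω h ht.2
    exact hh i hi
  have hmemP : ∀ v, Γ.Adj h v → v ∈ P.image C.c := by
    intro v hv
    obtain ⟨i, hi⟩ : ∃ i, C.c i = v := by
      by_contra! hcon
      exact hoff h v hh hcon hv
    obtain ⟨t, h1, h2, h3, -⟩ := C.exists_mem_Ico i 0
    refine Finset.mem_image.2 ⟨t, (hP t).2 ⟨⟨h1, by omega⟩, ?_⟩, h3.trans hi⟩
    rwa [h3, hi]
  have hωP : ω ∉ P.image C.c := by
    intro hm
    obtain ⟨t, ht, ht'⟩ := Finset.mem_image.1 hm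
    have h1 := h0P t ht
    have h2 := (hP t).1 ht
    have := C.eq_of_c_eq (ht'.trans h0.symm) (by omega) (by omega)
    omega
  have hd1 : k < P.card := by
    refine lt_of_lt_of_le ((attached_singleton hh).lt_card hconn rfl ?_ (P.image C.c) hωP ?_ ?_)
      Finset.card_image_le
    · rintro a rfl b hb hab
      exact absurd hab (hoff a b hh hb)
    · intro v hv
      obtain ⟨t, ht, rfl⟩ := Finset.mem_image.1 hv
      exact ⟨t, rfl, h, rfl, ((hP t).1 ht).2⟩
    · rintro i - ⟨z, rfl, hz⟩
      exact hmemP _ hz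
  have hd2 : 3 * k ≤ 2 * P.card + 1 := by
    have h1 := le_degree h hhω (P.image C.c) fun f _ hf => hmemP f hf
    have h2 : (P.image C.c).card ≤ P.card := Finset.card_image_le
    omega
  obtain ⟨m, hm⟩ : ∃ m, P.card = m + 1 := ⟨P.card - 1, by omega⟩
  have hm0 : (0 : ℤ) < m := by omega
  let e := P.orderEmbOfFin hm
  -- The value 0 beyond index m is never used.
  let E : ℕ → ℤ := fun i => if hi : i < m + 1 then e ⟨i, hi⟩ else 0
  have hEP : ∀ i, i ≤ m → E i ∈ P := by
    intro i hi
    have : E i = e ⟨i, by omega⟩ := dif_pos (by omega)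
    rw [this]
    exact Finset.orderEmbOfFin_mem _ _ _
  have hElt : ∀ i, i < m → E i < E (i + 1) := by
    intro i hi
    have h1 : E i = e ⟨i, by omega⟩ := dif_pos (by omega)
    have h2 : E (i + 1) = e ⟨i + 1, by omega⟩ := dif_pos (by omega)
    rw [h1, h2]
    exact e.strictMono (Fin.mk_lt_mk.2 (by omega))
  have hEsurj : ∀ t ∈ P, ∃ i, i ≤ m ∧ E i = t := by
    intro t ht
    have h1 := Finset.range_orderEmbOfFin P hm
    have h2 : t ∈ Set.range (P.orderEmbOfFin hm) := by rw [h1]; exact ht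
    obtain ⟨i, hi⟩ := h2
    exact ⟨i, by omega, by rw [← hi]; exact dif_pos i.2⟩
  have hE1 : ∀ i, i ≤ m → 1 ≤ E i := fun i hi => h0P _ (hEP i hi)
  have hEn : ∀ i, i ≤ m → E i < C.n := fun i hi => ((hP _).1 (hEP i hi)).1.2
  have hEh : ∀ i, i ≤ m → Γ.Adj h (C.c (E i)) := fun i hi => ((hP _).1 (hEP i hi)).2
  have hE2 : ∀ i, i < m → E i + 2 ≤ E (i + 1) := by
    intro i hi
    rcases (show E i + 1 ≤ E (i + 1) by have := hElt i hi; omega).lt_or_eq with h1 | h1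
    · omega
    · have h2 := hEh (i + 1) hi
      rw [← h1] at h2
      exact absurd h2 ((attached_singleton hh).not_adj_succ rfl rfl (hEh i hi.le))
  -- With ω at position 0, junction 0 reaches from `q 0 = E m - n` to `p 0 = E 0` and swallows the
  -- arc through ω. Hence `q` is indexed through `j - 1`, and the junctions number one fewer than
  -- the neighbours.
  let p : ℤ → ℤ := fun j => E (j % m).toNat + (j / m) * C.n
  let q : ℤ → ℤ := fun j => E (((j - 1) % m).toNat + 1) + ((j - 1) / m) * C.n
  have hp : ∀ (i : ℕ) (a : ℤ), i < m → p (i + a * m) = E i + a * C.n := by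
    intro i a hi
    have h1 : ((i : ℤ) + a * m) % m = i := by
      rw [Int.add_mul_emod_self_right, Int.emod_eq_of_lt (by omega) (by omega)]
    have h2 : ((i : ℤ) + a * m) / m = a := by
      rw [Int.add_mul_ediv_right _ _ hm0.ne', Int.ediv_eq_zero_of_lt (by omega) (by omega), zero_add]
    simp only [p, h1, h2, Int.toNat_natCast]
  have hq : ∀ (i : ℕ) (a : ℤ), i < m → q (i + a * m + 1) = E (i + 1) + a * C.n := by
    intro i a hi
    have h1 : ((i : ℤ) + a * m) % m = i := by
      rw [Int.add_mul_emod_self_right, Int.emod_eq_of_lt (by omega) (by omega)]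
    have h2 : ((i : ℤ) + a * m) / m = a := by
      rw [Int.add_mul_ediv_right _ _ hm0.ne', Int.ediv_eq_zero_of_lt (by omega) (by omega), zero_add]
    simp only [q, add_sub_cancel_right, h1, h2, Int.toNat_natCast]
  have hrep : ∀ j : ℤ, ∃ (i : ℕ) (a : ℤ), i < m ∧ j = i + a * m := by
    intro j
    have h1 := Int.emod_nonneg j hm0.ne'
    have h2 := Int.emod_lt_of_pos j hm0
    refine ⟨(j % m).toNat, j / m, by omega, ?_⟩
    have := Int.emod_add_mul_ediv j m
    rw [Int.toNat_of_nonneg h1]; linarith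
  have hrep1 : ∀ j : ℤ, ∃ (i : ℕ) (a : ℤ), i < m ∧ j = i + a * m + 1 := by
    intro j
    obtain ⟨i, a, h1, h2⟩ := hrep (j - 1)
    exact ⟨i, a, h1, by omega⟩
  refine Junctions.false (k := k)
    { toLongestCycle := C
      h := h
      off := hh
      m := m
      p := p
      q := q
      p_add := ?_
      q_add := ?_
      q_le := ?_
      p_add_two_le := ?_
      q_eq := ?_
      adj_p := ?_
      adj_q := ?_
      of_adj := ?_
      ne_omega := ?_
      indep_off := hoff
      free := free
      card_lt := card_lt
      le_degree := le_degree
      two_le := two_le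
      k_le := by omega
      le_m := by omega }
  · intro j
    obtain ⟨i, a, hi, rfl⟩ := hrep j
    rw [show (i : ℤ) + a * m + m = i + (a + 1) * m by ring, hp i _ hi, hp i _ hi]; ring
  · intro j
    obtain ⟨i, a, hi, rfl⟩ := hrep1 j
    rw [show (i : ℤ) + a * m + 1 + m = i + (a + 1) * m + 1 by ring, hq i _ hi, hq i _ hi]; ring
  · intro j
    obtain ⟨i, a, hi, rfl⟩ := hrep j
    rw [hp i a hi]
    rcases i.eq_zero_or_pos with rfl | hpos
    · have h1 := hq (m - 1) (a - 1) (by omega)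
      rw [show ((m - 1 : ℕ) : ℤ) + (a - 1) * m + 1 = (0 : ℕ) + a * m by
        push_cast [show 1 ≤ m by omega]; ring, show m - 1 + 1 = m by omega] at h1
      rw [h1]
      have h2 := hEn m le_rfl
      have h3 := hE1 0 (by omega)
      linarith
    · have h1 := hq (i - 1) a (by omega)
      rw [show ((i - 1 : ℕ) : ℤ) + a * m + 1 = i + a * m by
        push_cast [show 1 ≤ i by omega]; ring, show i - 1 + 1 = i by omega] at h1
      exact h1.le
  · intro j
    obtain ⟨i, a, hi, rfl⟩ := hrep j
    rw [hp i a hi, hq i a hi]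
    have := hE2 i hi
    linarith
  · intro j hj
    obtain ⟨i, a, hi, rfl⟩ := hrep j
    have hpos : 1 ≤ i := by
      by_contra hlt
      obtain rfl : i = 0 := by omega
      exact hj ⟨a, by push_cast; ring⟩
    rw [hp i a hi]
    have h1 := hq (i - 1) a (by omega)
    rwa [show ((i - 1 : ℕ) : ℤ) + a * m + 1 = i + a * m by
      push_cast [hpos]; ring, show i - 1 + 1 = i by omega] at h1
  · intro j
    obtain ⟨i, a, hi, rfl⟩ := hrep j
    rw [hp i a hi, C.periodic_mul]
    exact hEh i hi.le
  · intro j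
    obtain ⟨i, a, hi, rfl⟩ := hrep1 j
    rw [hq i a hi, C.periodic_mul]
    exact hEh (i + 1) hi
  · intro t ht
    obtain ⟨s, h1, h2, h3, a, ha⟩ := C.exists_mem_Ico t 0
    obtain ⟨i, hi, rfl⟩ := hEsurj s ((hP s).2 ⟨⟨h1, by omega⟩, by rwa [h3]⟩)
    rcases hi.lt_or_eq with hi | rfl
    · exact ⟨i + a * m, Or.inl (by rw [hp i a hi]; linarith)⟩
    · refine ⟨(i - 1 : ℕ) + a * i + 1, Or.inr ?_⟩
      rw [hq (i - 1) a (by omega), show i - 1 + 1 = i by omega]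
      linarith
  · intro j t h1 h2 h3
    obtain ⟨i, a, hi, rfl⟩ := hrep j
    rw [hp i a hi] at h1
    rw [hq i a hi] at h2
    have h4 := hE1 i hi.le
    have h5 := hEn (i + 1) hi
    have h6 : C.c (t - a * C.n) = C.c 0 := by
      refine Eq.trans ?_ (h3.trans h0.symm)
      rw [← C.periodic_mul (t - a * C.n) a, sub_add_cancel]
    have := C.eq_of_c_eq h6 (by linarith) (by linarith)
    linarith

end LongestCycle

end SimpleGraph

/-! ### Induced K₂ ∪ kK₁ and toughness. -/

namespace SimpleGraph

variable {V : Type*} {G : SimpleGraph V} {k : ℕ}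

lemma IsK2UnionKK1Free.card_lt (hfree : G.IsK2UnionKK1Free k) {a b : V} (hab : G.Adj a b)
    (I : Finset V) (hI : ∀ x ∈ I, ∀ y ∈ I, ¬ G.Adj x y)
    (hIab : ∀ x ∈ I, ¬ G.Adj a x ∧ ¬ G.Adj b x) : I.card < k := by
  by_contra hlt
  obtain ⟨K, hK, rfl⟩ := Finset.exists_subset_card_eq (not_lt.1 hlt)
  refine hfree ⟨⟨⟨Sum.elim ![a, b] fun i => (K.equivFin.symm i : V), ?_⟩, ?_⟩⟩
  · have hmem : ∀ i, ((K.equivFin.symm i : K) : V) ∈ I := fun i => hK (K.equivFin.symm i).2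
    have ha : ∀ i, a ≠ (K.equivFin.symm i : V) := by
      intro i h
      exact (hIab _ (hmem i)).2 (h ▸ hab.symm)
    have hb : ∀ i, b ≠ (K.equivFin.symm i : V) := by
      intro i h
      exact (hIab _ (hmem i)).1 (h ▸ hab)
    rintro (i | i) (j | j) hij
    · fin_cases i <;> fin_cases j <;> simp_all [hab.ne, hab.ne']
    · fin_cases i
      · exact absurd hij (ha j)
      · exact absurd hij (hb j)
    · fin_cases j
      · exact absurd hij.symm (ha i)
      · exact absurd hij.symm (hb i)
    · simpa using hij
  · have hmem : ∀ i, ((K.equivFin.symm i : K) : V) ∈ I := fun i => hK (K.equivFin.symm i).2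
    have key : ∀ i j, G.Adj (Sum.elim ![a, b] (fun i => ((K.equivFin.symm i : K) : V)) i)
        (Sum.elim ![a, b] (fun i => ((K.equivFin.symm i : K) : V)) j) ↔
          ((⊤ : SimpleGraph (Fin 2)) ⊕g (⊥ : SimpleGraph (Fin K.card))).Adj i j := by
      rintro (i | i) (j | j)
      · fin_cases i <;> fin_cases j <;> simp [hab, hab.symm]
      · fin_cases i
        · simpa using (hIab _ (hmem j)).1
        · simpa using (hIab _ (hmem j)).2
      · fin_cases j
        · simpa [G.adj_comm] using (hIab _ (hmem i)).1
        · simpa [G.adj_comm] using (hIab _ (hmem i)).2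
      · simpa using hI _ (hmem i) _ (hmem j)
    exact fun {i j} => key i j

section Toughness

variable [Fintype V]

lemma numComponentsDelete_of_indep [DecidableEq V] {S : Finset V}
    (h : ∀ x ∉ S, ∀ y ∉ S, ¬ G.Adj x y) : G.numComponentsDelete S = (Sᶜ).card := by
  have hbot : G.induce {v | v ∉ S} = ⊥ := by
    ext x y
    simpa using h x x.2 y y.2
  have hbij : Function.Bijective (G.induce {v | v ∉ S}).connectedComponentMk := by
    refine ⟨fun x y hxy => ?_, fun c => c.exists_rep⟩
    have := ConnectedComponent.exact hxy
    rwa [hbot, reachable_bot] at this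
  rw [numComponentsDelete, ← Nat.card_congr (Equiv.ofBijective _ hbij),
    Nat.card_eq_fintype_card]
  refine Fintype.card_of_subtype _ fun x => ?_
  simp

lemma numComponentsDelete_le (S : Finset V) : G.numComponentsDelete S ≤ Fintype.card V := by
  classical
  rw [numComponentsDelete, ← Nat.card_eq_fintype_card]
  refine (Nat.card_le_card_of_surjective (G.induce {v | v ∉ S}).connectedComponentMk
    fun c => c.exists_rep).trans ?_
  exact Nat.card_le_card_of_injective (Subtype.val : {v | v ∉ S} → V) Subtype.val_injective

/-- If the inequality fails, one vertex from each component not containing a given edge provides at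
least k isolated vertices. So `G - S` has no edge and is too large an independent set. -/
lemma numComponentsDelete_lt (hconn : G.IsVertexConnected (k + 1)) (hfree : G.IsK2UnionKK1Free k)
    (hα : 2 * G.indepNum < Fintype.card V) {S : Finset V} (hS : 2 ≤ G.numComponentsDelete S) :
    G.numComponentsDelete S < S.card := by
  classical
  have hkS : k + 1 ≤ S.card := by
    by_contra hlt
    have h1 := hconn.2 S (not_le.1 hlt)
    have h2 := h1.preconnected.subsingleton_connectedComponent
    have : G.numComponentsDelete S ≤ 1 := Finite.card_le_one_iff_subsingleton.2 h2
    omega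
  by_contra hle
  have hindep : ∀ x ∉ S, ∀ y ∉ S, ¬ G.Adj x y := by
    intro a ha b hb hab
    let H := G.induce {v | v ∉ S}
    let rep : H.ConnectedComponent → {v | v ∉ S} := fun c => c.out
    have hrep : ∀ c, H.connectedComponentMk (rep c) = c := fun c => Quot.out_eq c
    have hinj : Function.Injective fun c => (rep c : V) := by
      intro c c' h
      rw [← hrep c, ← hrep c', Subtype.ext h]
    let c₀ := H.connectedComponentMk ⟨a, ha⟩
    have hb₀ : H.connectedComponentMk ⟨b, hb⟩ = c₀ :=
      ConnectedComponent.sound (Adj.reachable (show H.Adj _ _ from hab.symm))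
    have hne : ∀ x y : {v | v ∉ S}, G.Adj x y →
        H.connectedComponentMk x = H.connectedComponentMk y := fun x y hxy =>
      ConnectedComponent.sound (Adj.reachable (show H.Adj _ _ from hxy))
    have := hfree.card_lt hab ((Finset.univ.erase c₀).image fun c => (rep c : V)) ?_ ?_
    · rw [Finset.card_image_of_injective _ hinj, Finset.card_erase_of_mem (Finset.mem_univ _),
        Finset.card_univ, ← Nat.card_eq_fintype_card] at this
      have h3 : Nat.card H.ConnectedComponent = G.numComponentsDelete S := rfl
      omega
    · intro x hx y hy hxy
      obtain ⟨c, -, rfl⟩ := Finset.mem_image.1 hx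
      obtain ⟨c', -, rfl⟩ := Finset.mem_image.1 hy
      have := hne _ _ hxy
      rw [hrep, hrep] at this
      exact G.irrefl (this ▸ hxy)
    · intro x hx
      obtain ⟨c, hc, rfl⟩ := Finset.mem_image.1 hx
      rw [Finset.mem_erase] at hc
      refine ⟨fun h => ?_, fun h => ?_⟩
      · have := hne ⟨a, ha⟩ (rep c) h
        rw [hrep] at this
        exact hc.1 this.symm
      · have := hne ⟨b, hb⟩ (rep c) h
        rw [hrep, hb₀] at this
        exact hc.1 this.symm
  have h1 : G.IsIndepSet (Sᶜ : Finset V) := by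
    intro x hx y hy _
    exact hindep x (by simpa using hx) y (by simpa using hy)
  have h2 := h1.card_le_indepNum
  rw [numComponentsDelete_of_indep hindep] at hle
  have h3 := Finset.card_add_card_compl S
  omega

theorem indepNum_lt_iff_one_lt_toughness (hk : 2 ≤ k) (hconn : G.IsVertexConnected (k + 1))
    (hfree : G.IsK2UnionKK1Free k) : 2 * G.indepNum < Fintype.card V ↔ 1 < G.toughness := by
  classical
  have hn : k + 1 < Fintype.card V := by rw [← Nat.card_eq_fintype_card]; exact hconn.1
  constructor
  · intro hα
    -- A strict bound must survive the infimum: |S| ≥ ω(G - S) + 1 and ω(G - S) ≤ n make every ratio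
    -- at least 1 + 1/n.
    have h1 : (1 : ENNReal) < 1 + (Fintype.card V : ENNReal)⁻¹ := by
      refine ENNReal.lt_add_right ENNReal.one_ne_top ?_
      exact ENNReal.inv_ne_zero.2 (ENNReal.natCast_ne_top _)
    refine h1.trans_le (le_iInf₂ fun S hS => ?_)
    have h2 := numComponentsDelete_lt hconn hfree hα hS
    have h3 := G.numComponentsDelete_le S
    rw [ENNReal.le_div_iff_mul_le (Or.inl (by simp; omega))
      (Or.inl (ENNReal.natCast_ne_top _)), add_mul, one_mul]
    calc (G.numComponentsDelete S : ENNReal) +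
          (Fintype.card V : ENNReal)⁻¹ * G.numComponentsDelete S
        ≤ G.numComponentsDelete S + (Fintype.card V : ENNReal)⁻¹ * Fintype.card V := by
          gcongr
      _ = ((G.numComponentsDelete S + 1 : ℕ) : ENNReal) := by
          rw [ENNReal.inv_mul_cancel (by simp; omega) (ENNReal.natCast_ne_top _)]
          push_cast; rfl
      _ ≤ S.card := by exact_mod_cast h2
  · intro ht
    obtain ⟨s, hs⟩ := G.exists_isNIndepSet_indepNum
    by_contra hα
    have hcard : s.card = G.indepNum := hs.card_eq
    have hcomp : G.numComponentsDelete sᶜ = s.card := by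
      rw [numComponentsDelete_of_indep, compl_compl]
      intro x hx y hy hxy
      simp only [Finset.mem_compl, not_not] at hx hy
      exact hs.isIndepSet hx hy hxy.ne hxy
    have h0 : 2 ≤ G.numComponentsDelete sᶜ := by omega
    have h1 : 1 < ((sᶜ).card : ENNReal) / (G.numComponentsDelete sᶜ : ENNReal) :=
      ht.trans_le (iInf₂_le (f := fun (S : Finset V) (_ : 2 ≤ G.numComponentsDelete S) =>
        (S.card : ENNReal) / (G.numComponentsDelete S : ENNReal)) sᶜ h0)
    have h2 := Finset.card_add_card_compl s
    rw [hcomp, ENNReal.lt_div_iff_mul_lt (Or.inl (Nat.cast_ne_zero.2 (by omega)))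
      (Or.inl (ENNReal.natCast_ne_top _)), one_mul] at h1
    have h3 : s.card < (sᶜ).card := by exact_mod_cast h1
    omega

end Toughness

end SimpleGraph

/-! ### The auxiliary vertex: spanning paths from spanning cycles. -/

namespace SimpleGraph

section Construction

variable {X : Type*} {Γ : SimpleGraph X} {ω : X}

/-- A closed list of maximal length through `ω` gives a longest cycle. -/
noncomputable def LongestCycle.ofList (l : List X) {a b : X} (hl : PathList Γ l a b)
    (hba : Γ.Adj b a) (hnd : l.Nodup) (hω : ω ∈ l) (h3 : 3 ≤ l.length)
    (hmax : ∀ l' a b, PathList Γ l' a b → Γ.Adj b a → l'.Nodup → ω ∈ l' → l'.length ≤ l.length) :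
    LongestCycle Γ ω where
  n := l.length
  -- The index is reduced modulo the length, so the default `ω` is never read.
  c i := l.getD (i % l.length).toNat ω
  periodic i := by rw [Int.add_emod_right]
  inj i j h := by
    have hn : (0 : ℤ) < l.length := by omega
    have h1 := Int.emod_nonneg i hn.ne'
    have h2 := Int.emod_lt_of_pos i hn
    have h3 := Int.emod_nonneg j hn.ne'
    have h4 := Int.emod_lt_of_pos j hn
    rw [List.getD_eq_getElem _ _ (by omega), List.getD_eq_getElem _ _ (by omega),
      hnd.getElem_inj_iff] at h
    exact Int.ModEq.dvd (show j % _ = i % _ by omega)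
  adj i := by
    have hn : (0 : ℤ) < l.length := by omega
    have h1 := Int.emod_nonneg i hn.ne'
    have h2 := Int.emod_lt_of_pos i hn
    obtain ⟨hc, hh, ht⟩ := hl
    have h4 : (i + 1) % (l.length : ℤ) = (i % l.length + 1) % l.length := by
      rw [Int.emod_add_emod]
    rcases (show i % (l.length : ℤ) + 1 ≤ l.length by omega).lt_or_eq with h5 | h5
    · rw [h4, Int.emod_eq_of_lt (by omega) h5, List.getD_eq_getElem _ _ (by omega),
        List.getD_eq_getElem _ _ (by omega)]
      have := List.isChain_iff_getElem.1 hc (i % l.length).toNat (by omega)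
      convert this using 2
      omega
    · rw [h4, h5, Int.emod_self, List.getD_eq_getElem _ _ (by omega),
        List.getD_eq_getElem _ _ (by omega)]
      rw [List.head?_eq_getElem?, List.getElem?_eq_some_iff] at hh
      rw [List.getLast?_eq_getElem?, List.getElem?_eq_some_iff] at ht
      obtain ⟨_, hh⟩ := hh
      obtain ⟨_, ht⟩ := ht
      have h6 : (i % (l.length : ℤ)).toNat = l.length - 1 := by omega
      simp only [h6, ht, Int.toNat_zero, hh]
      exact hba
  three_le := h3
  exists_eq := by
    obtain ⟨i, hi, h⟩ := List.getElem_of_mem hω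
    refine ⟨i, ?_⟩
    rw [Int.emod_eq_of_lt (by omega) (by omega), Int.toNat_natCast, List.getD_eq_getElem _ _ hi, h]
  length_le := hmax

lemma LongestCycle.nonempty [Fintype X] {l : List X} {a b : X} (hl : PathList Γ l a b)
    (hba : Γ.Adj b a) (hnd : l.Nodup) (hω : ω ∈ l) (h3 : 3 ≤ l.length) :
    Nonempty (LongestCycle Γ ω) := by
  classical
  let P : ℕ → Prop := fun n => ∃ l a b, PathList Γ l a b ∧ Γ.Adj b a ∧ l.Nodup ∧ ω ∈ l ∧
    l.length = n
  have hle : ∀ n, P n → n ≤ Fintype.card X := by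
    rintro _ ⟨l, -, -, -, -, h, -, rfl⟩
    exact h.length_le_card
  have h0 : P l.length := ⟨l, a, b, hl, hba, hnd, hω, rfl⟩
  obtain ⟨l', a', b', h1, h2, h4, h5, h6⟩ := Nat.findGreatest_spec (hle _ h0) h0
  have hmax : ∀ n, P n → n ≤ l'.length := fun n hn => by
    rw [h6]; exact Nat.le_findGreatest (hle n hn) hn
  exact ⟨LongestCycle.ofList l' h1 h2 h4 h5 (h3.trans (hmax _ h0))
    fun l'' a'' b'' g1 g2 g3 g4 => hmax _ ⟨l'', a'', b'', g1, g2, g3, g4, rfl⟩⟩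

end Construction

variable {V : Type*}

/-- `G` with a new vertex adjacent to `x` and `y`. -/
def addVertex (G : SimpleGraph V) (x y : V) : SimpleGraph (Option V) where
  Adj
    | some a, some b => G.Adj a b
    | some a, none => a = x ∨ a = y
    | none, some b => b = x ∨ b = y
    | none, none => False
  symm := ⟨by
    rintro (_ | a) (_ | b) h
    · exact h
    · exact h
    · exact h
    · exact G.adj_symm h⟩
  loopless := ⟨by
    rintro (_ | a) h
    · exact h
    · exact G.irrefl h⟩

section

variable {G : SimpleGraph V} {x y : V}

lemma addVertex_adj_none {z : Option V} (h : (G.addVertex x y).Adj z none) :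
    z = some x ∨ z = some y := by
  cases z with
  | none => exact absurd h (G.addVertex x y).irrefl
  | some a => exact h.imp (congrArg some) (congrArg some)

lemma exists_walk_of_pathList [DecidableEq V] {l : List V} {u v : V} (hl : PathList G l u v)
    (hnd : l.Nodup) (hall : ∀ a, a ∈ l) : ∃ p : G.Walk u v, p.IsHamiltonian := by
  obtain ⟨h1, h2, h3⟩ := hl
  have hne : l ≠ [] := by rintro rfl; simp at h2
  rw [List.head?_eq_some_head hne, Option.some.injEq] at h2
  rw [List.getLast?_eq_some_getLast hne, Option.some.injEq] at h3
  subst h2 h3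
  refine ⟨Walk.ofSupport l hne h1, fun a => ?_⟩
  rw [Walk.support_ofSupport]
  exact List.count_eq_one_of_mem hnd (hall a)

lemma PathList.of_map_some {l : List V} {u v : V}
    (h : PathList (G.addVertex x y) (l.map some) (some u) (some v)) : PathList G l u v := by
  obtain ⟨h1, h2, h3⟩ := h
  rw [List.isChain_map] at h1
  rw [List.head?_map] at h2
  rw [List.getLast?_map] at h3
  refine ⟨h1, ?_, ?_⟩
  · simpa using h2
  · simpa using h3

lemma PathList.map_some {l : List V} {u v : V} (h : PathList G l u v) :
    PathList (G.addVertex x y) (l.map some) (some u) (some v) := by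
  obtain ⟨h1, h2, h3⟩ := h
  refine ⟨?_, by simp [h2], by simp [h3]⟩
  rw [List.isChain_map]
  exact h1

/-- Any path from `x` to `y` closes up through the new vertex, so there is a cycle to maximise. -/
lemma exists_longestCycle_addVertex [Fintype V] (hG : G.Connected) (hxy : x ≠ y) :
    Nonempty (LongestCycle (G.addVertex x y) none) := by
  obtain ⟨p, hp⟩ := (hG.preconnected x y).exists_isPath
  have hl : PathList G p.support x y := by
    refine ⟨p.isChain_adj_support, ?_, ?_⟩
    · rw [List.head?_eq_some_head p.support_ne_nil]; simp
    · rw [List.getLast?_eq_some_getLast p.support_ne_nil]; simp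
  have hlen : 2 ≤ p.support.length := by
    rw [Walk.length_support]
    have : p.length ≠ 0 := fun h => hxy (Walk.eq_of_length_eq_zero h)
    omega
  refine LongestCycle.nonempty (((PathList.singleton _ none).append
    (hl.map_some (x := x) (y := y)) (Or.inl rfl))) (Or.inr rfl) ?_ (by simp)
    (by rw [List.length_append, List.length_map, List.length_singleton]; omega)
  simpa using hp.support_nodup.map (Option.some_injective V)

lemma LongestCycle.ends_addVertex (C : LongestCycle (G.addVertex x y) none) {r : ℤ}
    (hr : C.c r = none) : (C.c (r + 1) = some x ∧ C.c (r - 1) = some y) ∨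
      (C.c (r + 1) = some y ∧ C.c (r - 1) = some x) := by
  have h1 := C.adj r
  have h2 := C.adj (r - 1)
  rw [sub_add_cancel] at h2
  rw [hr] at h1 h2
  have hne : C.c (r + 1) ≠ C.c (r - 1) := by
    intro h
    have := C.three_le
    have := C.eq_of_c_eq h (by omega) (by omega)
    omega
  rcases addVertex_adj_none h1.symm with h3 | h3 <;> rcases addVertex_adj_none h2 with h4 | h4
  · exact absurd (h3.trans h4.symm) hne
  · exact Or.inl ⟨h3, h4⟩
  · exact Or.inr ⟨h3, h4⟩
  · exact absurd (h3.trans h4.symm) hne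

lemma LongestCycle.exists_hamiltonian [DecidableEq V] (C : LongestCycle (G.addVertex x y) none)
    (hC : ∀ v, ∃ i, C.c i = v) : ∃ p : G.Walk x y, p.IsHamiltonian := by
  obtain ⟨r, hr⟩ := hC none
  have h3 := C.three_le
  have hseg := C.pathList_seg (i := r + 1) (j := r + C.n) (e := r + C.n - 1) (by ring) (by omega)
  have hfull := C.seg_append (i := r) (j := r + 1) (k := r + C.n) (by omega) (by omega)
  rw [C.seg_succ, hr] at hfull
  have hnd := C.nodup_seg r
  rw [hfull, List.singleton_append, List.nodup_cons] at hnd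
  obtain ⟨l, hl⟩ : ∃ l : List V, l.map some = C.seg (r + 1) (r + C.n) := by
    have : C.seg (r + 1) (r + C.n) ∈ Set.range (List.map (some : V → Option V)) := by
      rw [Set.range_list_map]
      intro z hz
      cases z with
      | none => exact absurd hz hnd.1
      | some a => exact ⟨a, rfl⟩
    exact this
  rw [C.c_pred, ← hl] at hseg
  have hall : ∀ a, a ∈ l := by
    intro a
    obtain ⟨i, hi⟩ := hC (some a)
    obtain ⟨t, h1, h2, h4, -⟩ := C.exists_mem_Ico i r
    have : some a ∈ C.seg r (r + C.n) := C.mem_seg.2 ⟨t, h1, h2, h4.trans hi⟩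
    rw [hfull, ← hl] at this
    simpa using this
  have hnd' : l.Nodup := by
    rw [← hl] at hnd
    exact hnd.2.of_map _
  rcases C.ends_addVertex hr with ⟨h1, h2⟩ | ⟨h1, h2⟩
  · rw [h1, h2] at hseg
    exact exists_walk_of_pathList hseg.of_map_some hnd' hall
  · rw [h1, h2] at hseg
    exact exists_walk_of_pathList hseg.of_map_some.reverse (List.nodup_reverse.2 hnd')
      (by simpa using hall)

end

variable [Fintype V] [DecidableEq V] {G : SimpleGraph V} {k : ℕ}

omit [Fintype V] in
-- A closed set absorbs every walk of `G` that avoids S, and (k + 1)-connectivity supplies such a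
-- walk between any two remaining vertices.
lemma IsVertexConnected.mem_of_closed (hconn : G.IsVertexConnected (k + 1)) {x y : V}
    (S : Finset (Option V)) (hω : none ∉ S) (hS : S.card ≤ k) (Z : Set (Option V))
    (hZ : ∀ a ∈ Z, ∀ b, b ≠ none → b ∉ S → (G.addVertex x y).Adj a b → b ∈ Z) :
    ∀ a ∈ Z, ∀ b, a ≠ none → b ≠ none → a ∉ S → b ∉ S → b ∈ Z := by
  rintro (_ | a) ha (_ | b) ha' hb' haS hbS
  · exact absurd rfl ha'
  · exact absurd rfl ha'
  · exact absurd rfl hb'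
  have hT : S.eraseNone.card < k + 1 := by
    rw [Finset.card_eraseNone_eq_card_erase, Finset.erase_eq_of_notMem hω]; omega
  have hreach := (hconn.2 _ hT).preconnected ⟨a, by simpa using haS⟩ ⟨b, by simpa using hbS⟩
  obtain ⟨p⟩ := hreach
  have key : ∀ u v : {v | v ∉ S.eraseNone}, (G.induce {v | v ∉ S.eraseNone}).Walk u v →
      some (u : V) ∈ Z → some (v : V) ∈ Z := by
    intro u v p
    induction p with
    | nil => exact id
    | @cons u v w h p ih =>
      intro hu
      exact ih (hZ _ hu _ (by simp) (by simpa using v.2) h)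
  exact key _ _ p ha

theorem isHamiltonianConnected_of_free [DecidableRel G.Adj] (hk : 2 ≤ k)
    (hconn : G.IsVertexConnected (k + 1)) (hfree : G.IsK2UnionKK1Free k)
    (hδ : 3 * k ≤ 2 * G.minDegree + 1) (hα : 2 * G.indepNum < Fintype.card V) :
    G.IsHamiltonianConnected := by
  intro x y hxy
  have hG : G.Connected := by
    have h := hconn.2 ∅ (by simp)
    have hne : Nonempty V := ⟨x⟩
    refine ⟨fun a b => ?_⟩
    have := (h.preconnected ⟨a, by simp⟩ ⟨b, by simp⟩).map
      (Embedding.induce {v | v ∉ (∅ : Finset V)}).toHom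
    exact this
  obtain ⟨C⟩ := exists_longestCycle_addVertex hG hxy
  have hI : ∀ I : Finset (Option V), none ∉ I → I.eraseNone.card = I.card := fun I hI => by
    rw [Finset.card_eraseNone_eq_card_erase, Finset.erase_eq_of_notMem hI]
  refine C.exists_hamiltonian fun v => C.exists_c_eq (k := k)
    (fun S hω hS Z hZ => hconn.mem_of_closed S hω hS Z hZ) ?_ ?_ ?_ hk ?_ v
  · rintro (_ | a) (_ | b) ha hb hab I hω hI1 hI2
    · exact absurd rfl ha
    · exact absurd rfl ha
    · exact absurd rfl hb
    rw [← hI I hω]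
    refine hfree.card_lt hab _ ?_ ?_
    · intro u hu v hv huv
      exact hI1 _ (Finset.mem_eraseNone.1 hu) _ (Finset.mem_eraseNone.1 hv) huv
    · intro u hu
      exact hI2 _ (Finset.mem_eraseNone.1 hu)
  · intro I hω hI1
    rw [← hI I hω, Fintype.card_option]
    have h1 : G.IsIndepSet (I.eraseNone : Set V) := by
      intro u hu v hv _ huv
      rw [Finset.mem_coe, Finset.mem_eraseNone] at hu hv
      exact hI1 _ hu _ hv huv
    have := h1.card_le_indepNum
    omega
  · rintro (_ | v) hv S hS
    · exact absurd rfl hv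
    have h1 : G.degree v ≤ S.card := by
      rw [← G.card_neighborFinset_eq_degree]
      refine Finset.card_le_card_of_injOn some ?_ (Option.some_injective V).injOn
      intro u hu
      exact hS _ (by simp) ((G.mem_neighborFinset v u).1 hu)
    have h2 := G.minDegree_le_degree v
    omega
  · intro z hz
    obtain ⟨r, hr⟩ := C.exists_eq
    rcases addVertex_adj_none hz with rfl | rfl <;>
      rcases C.ends_addVertex hr with ⟨h1, h2⟩ | ⟨h1, h2⟩
    exacts [⟨_, h1⟩, ⟨_, h2⟩, ⟨_, h2⟩, ⟨_, h1⟩]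

end SimpleGraph

theorem theorem1p6 {V : Type*} [Fintype V] [DecidableEq V] (G : SimpleGraph V)
    [DecidableRel G.Adj] (k : ℕ) (hk : 2 ≤ k)
    (hconn : G.IsVertexConnected (k + 1)) (hfree : G.IsK2UnionKK1Free k) :
    ((G.indepNum : ℝ) < (Fintype.card V : ℝ) / 2 ↔ 1 < G.toughness) ∧
    ((3 * (k : ℝ) - 1) / 2 ≤ (G.minDegree : ℝ) →
      (G.indepNum : ℝ) < (Fintype.card V : ℝ) / 2 →
      G.IsHamiltonianConnected) := by
  have hα : (G.indepNum : ℝ) < (Fintype.card V : ℝ) / 2 ↔ 2 * G.indepNum < Fintype.card V := by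
    rw [lt_div_iff₀ (by norm_num), mul_comm]
    norm_cast
  rw [hα]
  refine ⟨SimpleGraph.indepNum_lt_iff_one_lt_toughness hk hconn hfree, fun hδ hα => ?_⟩
  refine SimpleGraph.isHamiltonianConnected_of_free hk hconn hfree ?_ hα
  have h : (3 * k : ℝ) ≤ 2 * G.minDegree + 1 := by linarith
  exact_mod_cast h
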